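/- Let $p$ be a prime and let $\mathcal{G}=(S,\mathcal{F},\mathcal{L})$ be a $p$-local compact group: $S$ is a discrete $p$-toral group, $\mathcal{F}$ is a saturated fusion system over $S$, and $\mathcal{L}$ is a centric linking system associated to $\mathcal{F}$ (a transporter system whose objects are all the $\mathcal{F}$-centric subgroups of $S$ and such that $\mathrm{Ker}(\mathrm{Aut}_{\mathcal{L}}(P)\to\mathrm{Aut}_{\mathcal{F}}(P))=\varepsilon(Z(P))$ for every object $P$), with structure functors $\mathcal{T}_{\mathrm{Ob}(\mathcal{L})}(S)\xrightarrow{\varepsilon}\mathcal{L}\xrightarrow{\rho}\mathcal{F}$, where $\mathcal{T}_{\mathrm{Ob}(\mathcal{L})}(S)$ is the transporter category of $S$. For $P\in\mathrm{Ob}(\mathcal{L})$ regard $N_S(P)$ as a subgroup of $\mathrm{Aut}_{\mathcal{L}}(P)$ via $\varepsilon$. A \emph{Robinson setup} for $\mathcal{G}$ consists of a finite set $\mathcal{P}=\{P_0=S,P_1,\dots,P_k\}$ of fully $\mathcal{F}$-normalised, $\mathcal{F}$-centric subgroups of $S$ that contains at least one representative of each $\mathcal{F}$-conjugacy class of $\mathcal{F}$-centric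 $\mathcal{F}$-radical subgroups, and, with $L_P=\mathrm{Aut}_{\mathcal{L}}(P)$ for $P\in\mathcal{P}$, for each $P\in\mathcal{P}$ with $P\neq S$ a group $N_P$ with monomorphisms $L_S\xleftarrow{k_P}N_P\xrightarrow{j_P}L_P$ and $N_S(P)\le N_P$, such that $k_P$ and $j_P$ restrict on $N_S(P)$ to the embeddings of $N_S(P)$ in $L_S$ and in $L_P$ given by $\varepsilon$. The \emph{Robinson amalgam} is the colimit $G$, in the category of groups, of the tree of groups with vertex groups $L_P$ ($P\in\mathcal{P}$) and, for each $S\ne P\in\mathcal{P}$, one edge joining the vertices of $S$ and $P$, with edge group $N_P$ and edge maps $k_P$, $j_P$. Let $\mathcal{O}(\mathcal{F}^c)$ be the category whose objects are the $\mathcal{F}$-centric subgroups of $S$ and whose morphism sets are $\mathrm{Inn}(Q)\backslash\mathrm{Hom}_{\mathcal{F}}(P,Q)$, let $\mathcal{Z}_{\mathcal{F}}\colon\mathcal{O}(\mathcal{F}^c)^{\mathrm{op}}\to\mathrm{Ab}$ be the functor that sends $P$ to $Z(P)$ and the class of $f\colon P\to Q$ to $f^{-1}\colon Z(Q)\to Z(P)$,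 and define the centre of $\mathcal{G}$ by $Z(\mathcal{G})=\varprojlim_{\mathcal{O}(\mathcal{F}^c)}\mathcal{Z}_{\mathcal{F}}$. Then for every Robinson setup for $\mathcal{G}$, with Robinson amalgam $G$, one has $Z(G)=Z(\mathcal{G})$; precisely, the canonical homomorphism $Z(\mathcal{G})\to Z(S)\le S\xrightarrow{\varepsilon}L_S\to G$ is injective and its image is the centre $Z(G)$ of $G$. -/

import Mathlib

open CategoryTheory CategoryTheory.Limits

universe u

/-! ### Discrete `p`-toral groups -/

/-- The group `ℤ/p^∞`, realised as the group of complex roots of unity of `p`-power order. -/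
abbrev PruferGroup (p : ℕ) : Type := CommGroup.primaryComponent ℂˣ p

/-- `P` has a normal discrete `p`-torus of rank `r` and index `m`, where `m` is a power of `p`;
that is, `P` is discrete `p`-toral of order `(r, m)`. -/
def HasToralOrder (p : ℕ) (P : Type*) [Group P] (r m : ℕ) : Prop :=
  ∃ T : Subgroup P, T.Normal ∧ Nonempty (T ≃* (Fin r → PruferGroup p)) ∧
    T.index = m ∧ ∃ a : ℕ, m = p ^ a

/-- Discrete `p`-toral groups. -/
def IsDiscretePToral (p : ℕ) (P : Type*) [Group P] : Prop :=
  ∃ r m : ℕ, HasToralOrder p P r m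

/-- `|P| ≤ |Q|` for discrete `p`-toral groups: lexicographic comparison of the pairs
(rank, index of the maximal torus). -/
def ToralOrderLE (p : ℕ) (P Q : Type*) [Group P] [Group Q] : Prop :=
  ∃ r m s n : ℕ, HasToralOrder p P r m ∧ HasToralOrder p Q s n ∧ (r < s ∨ (r = s ∧ m ≤ n))

/-- `H` is a Sylow `p`-subgroup of the (arbitrary) group `G`: it is discrete `p`-toral, and every
discrete `p`-toral subgroup of `G` is conjugate to a subgroup of `H`. -/
def IsSylowToral (p : ℕ) {G : Type*} [Group G] (H : Subgroup G) : Prop :=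
  IsDiscretePToral p H ∧
    ∀ K : Subgroup G, IsDiscretePToral p K → ∃ g : G, ∀ x ∈ K, g * x * g⁻¹ ∈ H

/-! ### Transporters and conjugation -/

section Conj

variable {S : Type u} [Group S]

/-- `g` lies in the transporter `N_S(P, Q)`, i.e. `g P g⁻¹ ≤ Q`. -/
def Transports (g : S) (P Q : Subgroup S) : Prop := ∀ x ∈ P, g * x * g⁻¹ ∈ Q

/-- The homomorphism `c_g : P → Q`, `x ↦ g x g⁻¹`. -/
def conjHom {P Q : Subgroup S} (g : S) (h : Transports g P Q) : P →* Q :=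
  ((MulAut.conj g).toMonoidHom.comp P.subtype).codRestrict Q (fun x => h x.1 x.2)

theorem Transports.of_le {P Q : Subgroup S} (h : P ≤ Q) : Transports 1 P Q := by
  intro x hx
  simpa using h hx

theorem Transports.mul {P Q R : Subgroup S} {g h : S} (hh : Transports h Q R)
    (hg : Transports g P Q) : Transports (h * g) P R := by
  intro x hx
  have := hh _ (hg x hx)
  simpa [mul_assoc] using this

theorem Transports.of_mem_normalizer {P : Subgroup S} {g : S}
    (hg : g ∈ Subgroup.normalizer (P : Set S)) : Transports g P P :=
  fun x hx => (Subgroup.mem_normalizer_iff.1 hg x).1 hx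

/-- `Aut_S(P)`: the automorphisms of `P` given by conjugation by elements of `N_S(P)`. -/
def autS (P : Subgroup S) : Subgroup (MulAut P) := P.normalizerMonoidHom.range

end Conj

/-- `Inn(P)`. -/
def innAut (P : Type*) [Group P] : Subgroup (MulAut P) := (MulAut.conj : P →* MulAut P).range

instance innAut_normal (P : Type*) [Group P] : (innAut P).Normal where
  conj_mem := by
    rintro _ ⟨x, rfl⟩ g
    refine ⟨g x, ?_⟩
    ext y
    simp

/-! ### Fusion systems -/

/-- A fusion system over `S`: for all subgroups `P, Q` of `S` a set of injective homomorphisms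
`P → Q`, containing those induced by conjugation in `S`, closed under composition, and such that
each morphism is an isomorphism of the system followed by an inclusion. -/
structure FusionSystem (S : Type u) [Group S] where
  Hom : ∀ P Q : Subgroup S, Set (P →* Q)
  conj_mem : ∀ {P Q : Subgroup S} (g : S) (h : Transports g P Q), conjHom g h ∈ Hom P Q
  injective : ∀ {P Q : Subgroup S}, ∀ f ∈ Hom P Q, Function.Injective f
  comp_mem : ∀ {P Q R : Subgroup S}, ∀ f ∈ Hom P Q, ∀ g ∈ Hom Q R, g.comp f ∈ Hom P R
  factor : ∀ {P Q : Subgroup S}, ∀ f ∈ Hom P Q, ∃ (R : Subgroup S) (hR : R ≤ Q) (e : P ≃* R),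
    e.toMonoidHom ∈ Hom P R ∧ e.symm.toMonoidHom ∈ Hom R P ∧
      f = (Subgroup.inclusion hR).comp e.toMonoidHom

namespace FusionSystem

variable {S : Type u} [Group S] (F : FusionSystem S)

theorem id_mem (P : Subgroup S) : MonoidHom.id P ∈ F.Hom P P := by
  have h := F.conj_mem (1 : S) (Transports.of_le (le_refl P))
  have e : conjHom (1 : S) (Transports.of_le (le_refl P)) = MonoidHom.id P := by
    ext x
    simp [conjHom]
  rwa [e] at h

/-- `e` is an isomorphism of the category `F`. -/
def IsIso {P Q : Subgroup S} (e : P ≃* Q) : Prop :=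
  e.toMonoidHom ∈ F.Hom P Q ∧ e.symm.toMonoidHom ∈ F.Hom Q P

/-- `F`-conjugacy of subgroups. -/
def IsConj (P Q : Subgroup S) : Prop := ∃ e : P ≃* Q, F.IsIso e

/-- `Aut_F(P)`. -/
def aut (P : Subgroup S) : Subgroup (MulAut P) where
  carrier := {e | F.IsIso e}
  one_mem' := ⟨F.id_mem P, F.id_mem P⟩
  mul_mem' := fun {_ _} ha hb => ⟨F.comp_mem _ hb.1 _ ha.1, F.comp_mem _ ha.2 _ hb.2⟩
  inv_mem' := fun {_} ha => ⟨ha.2, ha.1⟩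

/-- `Out_F(P) = Aut_F(P) / Inn(P)`. -/
abbrev Out (P : Subgroup S) : Type u := F.aut P ⧸ (innAut P).subgroupOf (F.aut P)

/-- `Out_S(P)`, the image of `Aut_S(P)` in `Out_F(P)`. -/
def outS (P : Subgroup S) : Subgroup (F.Out P) :=
  ((autS P).subgroupOf (F.aut P)).map (QuotientGroup.mk' _)

/-- Fully `F`-centralised subgroups. -/
def FullyCentralised (p : ℕ) (P : Subgroup S) : Prop :=
  ∀ P' : Subgroup S, F.IsConj P P' →
    ToralOrderLE p (Subgroup.centralizer (P' : Set S)) (Subgroup.centralizer (P : Set S))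

/-- Fully `F`-normalised subgroups. -/
def FullyNormalised (p : ℕ) (P : Subgroup S) : Prop :=
  ∀ P' : Subgroup S, F.IsConj P P' →
    ToralOrderLE p (Subgroup.normalizer (P' : Set S)) (Subgroup.normalizer (P : Set S))

/-- For an isomorphism `f : P → P'`, the subgroup
`N_f = {g ∈ N_S(P) | f c_g f⁻¹ ∈ Aut_S(P')}` of `S`. -/
def extender {P P' : Subgroup S} (f : P ≃* P') : Subgroup S :=
  ((autS P').comap ((MulAut.congr f).toMonoidHom.comp P.normalizerMonoidHom)).map
    (Subgroup.normalizer (P : Set S)).subtype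

/-- Saturated fusion systems. In `extension`, a morphism `P → S` with image `P'` is given as
an isomorphism `f : P ≃* P'`. -/
structure IsSaturated (p : ℕ) : Prop where
  sylow : ∀ P : Subgroup S, F.FullyNormalised p P →
    F.FullyCentralised p P ∧ Finite (F.Out P) ∧ IsSylowToral p (F.outS P)
  extension : ∀ (P P' : Subgroup S) (f : P ≃* P'), F.IsIso f → F.FullyCentralised p P' →
    ∃ f' ∈ F.Hom (extender f) ⊤, ∀ (x : S) (hx : x ∈ P) (hx' : x ∈ extender f),
      (f' ⟨x, hx'⟩ : S) = f ⟨x, hx⟩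
  union : ∀ (P : ℕ → Subgroup S), Monotone P →
    ∀ f : (⨆ n, P n : Subgroup S) →* (⊤ : Subgroup S),
      (∀ n, f.comp (Subgroup.inclusion (le_iSup P n)) ∈ F.Hom (P n) ⊤) → f ∈ F.Hom (⨆ n, P n) ⊤

/-- `F`-centric subgroups: `C_S(P') = Z(P')` for all `P'` that are `F`-conjugate to `P`. -/
def IsCentric (P : Subgroup S) : Prop :=
  ∀ P' : Subgroup S, F.IsConj P P' →
    Subgroup.centralizer (P' : Set S) = (Subgroup.center P').map P'.subtype

/-- `F`-radical subgroups: `Out_F(P)` has no nontrivial normal `p`-subgroup. -/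
def IsRadical (p : ℕ) (P : Subgroup S) : Prop :=
  ∀ K : Subgroup (F.Out P), K.Normal → IsPGroup p K → K = ⊥

/-- A fusion controlling family: a finite set of fully `F`-normalised subgroups that contains `S`
and a representative of each `F`-conjugacy class of `F`-centric `F`-radical subgroups. -/
structure IsFusionControlling (p : ℕ) (fam : Set (Subgroup S)) : Prop where
  finite : fam.Finite
  top_mem : ⊤ ∈ fam
  fullyNormalised : ∀ P ∈ fam, F.FullyNormalised p P
  exists_conj : ∀ Q : Subgroup S, F.IsCentric Q → F.IsRadical p Q → ∃ P ∈ fam, F.IsConj Q P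

/-! ### The centric orbit category and the centre functor -/

/-- The objects of the orbit category `O(F^c)`: the `F`-centric subgroups of `S`. -/
structure OrbitCat where
  sub : Subgroup S
  centric : F.IsCentric sub

variable {F}

/-- Two morphisms `P → Q` of `F` agree in `Rep_F(P, Q) = Inn(Q) \ Hom_F(P, Q)`. -/
def repSetoid (P Q : Subgroup S) : Setoid (F.Hom P Q) where
  r f g := ∃ q : Q, ∀ x : P, g.1 x = q * f.1 x * q⁻¹
  iseqv :=
    { refl := fun f => ⟨1, by simp⟩
      symm := by
        rintro f g ⟨q, hq⟩
        refine ⟨q⁻¹, fun x => ?_⟩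
        rw [hq]
        group
      trans := by
        rintro f g h ⟨q, hq⟩ ⟨r, hr⟩
        refine ⟨r * q, fun x => ?_⟩
        rw [hr, hq]
        group }

/-- The orbit category `O(F^c)`, with morphism sets `Rep_F(P, Q)`. -/
instance : Category.{u} (OrbitCat F) where
  Hom P Q := Quotient (repSetoid (F := F) P.sub Q.sub)
  id P := Quotient.mk _ ⟨MonoidHom.id P.sub, F.id_mem P.sub⟩
  comp {P Q R} := Quotient.map₂ (fun f g => ⟨g.1.comp f.1, F.comp_mem _ f.2 _ g.2⟩) (by
    rintro f f' ⟨q, hq⟩ g g' ⟨r, hr⟩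
    refine ⟨r * g.1 q, fun x => ?_⟩
    simp only [MonoidHom.comp_apply, hr, hq, map_mul, map_inv]
    group)
  id_comp := by
    rintro P Q ⟨f⟩
    rfl
  comp_id := by
    rintro P Q ⟨f⟩
    rfl
  assoc := by
    rintro P Q R T ⟨f⟩ ⟨g⟩ ⟨h⟩
    rfl

/-- If `P` is centric and `f : P → Q` is in `F`, then `Z(Q) ≤ f(P)`; more precisely each
`z ∈ Z(Q)` is `f(x)` for some `x ∈ Z(P)`. -/
theorem exists_center_preimage {P Q : Subgroup S} (hP : F.IsCentric P) {f : P →* Q}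
    (hf : f ∈ F.Hom P Q) (z : Subgroup.center Q) : ∃ x : Subgroup.center P, f x = z := by
  obtain ⟨R, hR, e, he, he', rfl⟩ := F.factor f hf
  have hz : ((z : Q) : S) ∈ Subgroup.centralizer (R : Set S) := by
    rw [Subgroup.mem_centralizer_iff]
    intro y hy
    exact congrArg Subtype.val (Subgroup.mem_center_iff.1 z.2 ⟨y, hR hy⟩)
  rw [hP R ⟨e, he, he'⟩] at hz
  obtain ⟨w, hw, hwz⟩ := hz
  refine ⟨⟨e.symm w, ?_⟩, ?_⟩
  · rw [Subgroup.mem_center_iff]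
    intro g
    apply e.injective
    simpa using Subgroup.mem_center_iff.1 hw (e g)
  · apply Subtype.ext
    simpa using hwz

/-- The homomorphism `Z(Q) → Z(P)`, `z ↦ f⁻¹(z)`, induced by a morphism `f : P → Q` of `F`
with `P` centric. -/
noncomputable def centerMap {P Q : Subgroup S} (hP : F.IsCentric P) (f : F.Hom P Q) :
    Subgroup.center Q →* Subgroup.center P :=
  MonoidHom.mk' (fun z => (exists_center_preimage hP f.2 z).choose) (by
    intro a b
    apply Subtype.ext
    apply F.injective f.1 f.2
    rw [(exists_center_preimage hP f.2 (a * b)).choose_spec, Subgroup.coe_mul, Subgroup.coe_mul,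
      map_mul, (exists_center_preimage hP f.2 a).choose_spec,
      (exists_center_preimage hP f.2 b).choose_spec])

theorem apply_centerMap {P Q : Subgroup S} (hP : F.IsCentric P) (f : F.Hom P Q)
    (z : Subgroup.center Q) : f.1 (centerMap hP f z) = z :=
  (exists_center_preimage hP f.2 z).choose_spec

theorem centerMap_eq_of_apply {P Q : Subgroup S} (hP : F.IsCentric P) (f : F.Hom P Q)
    (z : Subgroup.center Q) (x : Subgroup.center P) (h : f.1 x = z) : centerMap hP f z = x := by
  apply Subtype.ext
  apply F.injective f.1 f.2
  rw [apply_centerMap, h]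

theorem centerMap_congr {P Q : Subgroup S} (hP : F.IsCentric P) (f g : F.Hom P Q)
    (h : repSetoid (F := F) P Q f g) : centerMap hP f = centerMap hP g := by
  obtain ⟨q, hq⟩ := h
  ext1 z
  refine centerMap_eq_of_apply hP f z _ ?_
  have h1 := apply_centerMap hP g z
  rw [hq] at h1
  have h2 : f.1 (centerMap hP g z) = q⁻¹ * z * q := by
    rw [← h1]
    group
  rw [h2, mul_assoc, ← Subgroup.mem_center_iff.1 z.2 q]
  group

variable (F)

open scoped IsMulCommutative in
/-- The functor `Z_F : O(F^c)ᵒᵖ → Ab` sending `P` to its centre and the class of `f : P → Q` to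
the homomorphism `f⁻¹ : Z(Q) → Z(P)`. -/
noncomputable def centerFunctor : (OrbitCat F)ᵒᵖ ⥤ CommGrpCat.{u} where
  obj P := CommGrpCat.of (Subgroup.center P.unop.sub)
  map {Q P} φ := CommGrpCat.ofHom
    (Quotient.lift (fun f => centerMap P.unop.centric f) (centerMap_congr P.unop.centric) φ.unop)
  map_id P := by
    refine CommGrpCat.hom_ext (MonoidHom.ext fun z => ?_)
    exact centerMap_eq_of_apply P.unop.centric
      ⟨MonoidHom.id P.unop.sub, F.id_mem P.unop.sub⟩ z z rfl
  map_comp := by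
    rintro ⟨R⟩ ⟨Q⟩ ⟨P⟩ ⟨γ⟩ ⟨φ⟩
    induction γ using Quotient.inductionOn with | _ g
    induction φ using Quotient.inductionOn with | _ f
    refine CommGrpCat.hom_ext (MonoidHom.ext fun z => ?_)
    refine centerMap_eq_of_apply P.centric
      ⟨g.1.comp f.1, F.comp_mem _ f.2 _ g.2⟩ z (centerMap P.centric f (centerMap Q.centric g z)) ?_
    rw [MonoidHom.comp_apply, apply_centerMap, apply_centerMap]

end FusionSystem

/-! ### Transporter systems and centric linking systems -/

/-- The members of a collection `H` of subgroups, as a type carrying no order, so that it can be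
the type of objects of a category. -/
structure SubgroupIn {S : Type u} [Group S] (H : Set (Subgroup S)) where
  sub : Subgroup S
  mem : sub ∈ H

/-- A category `T` whose objects are subgroups of `S`, with functors
`T_{Ob T}(S) --ε--> T --ρ--> F` that are the identity, respectively the inclusion, on objects. -/
structure TransporterData {S : Type u} [Group S] (F : FusionSystem S) where
  obj : Set (Subgroup S)
  cat : Category.{u} (SubgroupIn obj)
  ε : ∀ {P Q : SubgroupIn obj} (g : S), Transports g P.sub Q.sub → (P ⟶ Q)
  ε_id : ∀ P : SubgroupIn obj, ε (1 : S) (Transports.of_le (le_refl P.sub)) = 𝟙 P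
  ε_comp : ∀ {P Q R : SubgroupIn obj} (g h : S) (hg : Transports g P.sub Q.sub)
    (hh : Transports h Q.sub R.sub), ε (h * g) (hh.mul hg) = ε g hg ≫ ε h hh
  ρ : ∀ {P Q : SubgroupIn obj}, (P ⟶ Q) → (P.sub →* Q.sub)
  ρ_mem : ∀ {P Q : SubgroupIn obj} (φ : P ⟶ Q), ρ φ ∈ F.Hom P.sub Q.sub
  ρ_id : ∀ P : SubgroupIn obj, ρ (𝟙 P) = MonoidHom.id P.sub
  ρ_comp : ∀ {P Q R : SubgroupIn obj} (φ : P ⟶ Q) (ψ : Q ⟶ R), ρ (φ ≫ ψ) = (ρ ψ).comp (ρ φ)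

attribute [instance] TransporterData.cat

namespace TransporterData

variable {S : Type u} [Group S] {F : FusionSystem S} (T : TransporterData F)

/-- The homomorphism `ε_{P,P} : N_S(P) → Aut_T(P)`. -/
def εAut (P : SubgroupIn T.obj) : Subgroup.normalizer (P.sub : Set S) →* Aut P where
  toFun g :=
    { hom := T.ε g.1 (Transports.of_mem_normalizer g.2)
      inv := T.ε (g⁻¹).1 (Transports.of_mem_normalizer (g⁻¹).2)
      hom_inv_id := by
        rw [← T.ε_comp, ← T.ε_id]
        congr 1
        simp
      inv_hom_id := by
        rw [← T.ε_comp, ← T.ε_id]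
        congr 1
        simp }
  map_one' := by
    ext
    exact T.ε_id P
  map_mul' g h := by
    ext
    exact T.ε_comp _ _ _ _

/-- The homomorphism `Aut_T(P) → Aut(P)` induced by `ρ`. -/
def ρAut (P : SubgroupIn T.obj) : Aut P →* MulAut P.sub where
  toFun a := MonoidHom.toMulEquiv (T.ρ a.hom) (T.ρ a.inv)
    (by rw [← T.ρ_comp, a.hom_inv_id, T.ρ_id]) (by rw [← T.ρ_comp, a.inv_hom_id, T.ρ_id])
  map_one' := by
    ext x
    exact congrArg (fun f : P.sub →* P.sub => (f x : S)) (T.ρ_id P)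
  map_mul' a b := by
    ext x
    exact congrArg (fun f : P.sub →* P.sub => (f x : S)) (T.ρ_comp b.hom a.hom)

/-- `E(P) = Ker(Aut_T(P) → Aut_F(P))`. -/
def E (P : SubgroupIn T.obj) : Subgroup (Aut P) := (T.ρAut P).ker

/-- The inclusion morphism `ε_{P,Q}(1)` for `P ≤ Q`. -/
def incl {P Q : SubgroupIn T.obj} (h : P.sub ≤ Q.sub) : P ⟶ Q := T.ε 1 (Transports.of_le h)

/-- The axioms of a transporter system associated to `F`. -/
structure IsTransporterSystem (p : ℕ) : Prop where
  top_mem : ⊤ ∈ T.obj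
  conj_mem : ∀ P Q : Subgroup S, P ∈ T.obj → F.IsConj P Q → Q ∈ T.obj
  overgroup_mem : ∀ P Q : Subgroup S, P ∈ T.obj → P ≤ Q → Q ∈ T.obj
  free_right : ∀ {P Q : SubgroupIn T.obj} (φ : P ⟶ Q), ∀ a ∈ T.E P, a.hom ≫ φ = φ → a = 1
  ρ_surjective : ∀ {P Q : SubgroupIn T.obj}, ∀ f ∈ F.Hom P.sub Q.sub, ∃ φ : P ⟶ Q, T.ρ φ = f
  ρ_orbit : ∀ {P Q : SubgroupIn T.obj} (φ ψ : P ⟶ Q),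
    T.ρ φ = T.ρ ψ ↔ ∃ a ∈ T.E P, a.hom ≫ φ = ψ
  free_left : ∀ {P Q : SubgroupIn T.obj} (φ : P ⟶ Q), ∀ a ∈ T.E Q, φ ≫ a.hom = φ → a = 1
  ε_injective : ∀ {P Q : SubgroupIn T.obj} (g h : S) (hg : Transports g P.sub Q.sub)
    (hh : Transports h P.sub Q.sub), (T.ε g hg : P ⟶ Q) = T.ε h hh → g = h
  ρ_ε : ∀ {P Q : SubgroupIn T.obj} (g : S) (hg : Transports g P.sub Q.sub),
    T.ρ (T.ε g hg : P ⟶ Q) = conjHom g hg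
  comm : ∀ {P Q : SubgroupIn T.obj} (φ : P ⟶ Q) (g : P.sub),
    (T.εAut P ⟨g, Subgroup.le_normalizer g.2⟩).hom ≫ φ =
      φ ≫ (T.εAut Q ⟨T.ρ φ g, Subgroup.le_normalizer (T.ρ φ g).2⟩).hom
  sylow : IsSylowToral p (T.εAut ⟨⊤, top_mem⟩).range
  extension : ∀ {P P' R R' : SubgroupIn T.obj} (φ : P ≅ P') (hR : P.sub ≤ R.sub)
    (hR' : P'.sub ≤ R'.sub) (hN : R.sub ≤ Subgroup.normalizer (P.sub : Set S))
    (hN' : R'.sub ≤ Subgroup.normalizer (P'.sub : Set S)),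
    (∀ r : R.sub, ∃ r' : R'.sub,
      φ.inv ≫ (T.εAut P ⟨r, hN r.2⟩).hom ≫ φ.hom = (T.εAut P' ⟨r', hN' r'.2⟩).hom) →
    ∃ φ' : R ⟶ R', T.incl hR ≫ φ' = φ.hom ≫ T.incl hR'
  union : ∀ (P : ℕ → SubgroupIn T.obj) (hP : ∀ n, (P n).sub ≤ (P (n + 1)).sub)
    (φ : ∀ n, P n ⟶ (⟨⊤, top_mem⟩ : SubgroupIn T.obj)),
    (∀ n, φ n = T.incl (hP n) ≫ φ (n + 1)) →
    ∀ (Q : SubgroupIn T.obj) (hQ : Q.sub = ⨆ n, (P n).sub),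
      ∃ ψ : Q ⟶ (⟨⊤, top_mem⟩ : SubgroupIn T.obj),
        ∀ n, φ n = T.incl (hQ ▸ le_iSup (fun n => (P n).sub) n) ≫ ψ

/-- Centric linking systems: transporter systems whose objects are the `F`-centric subgroups and
for which `E(P) = ε(Z(P))`. -/
structure IsCentricLinkingSystem (p : ℕ) : Prop extends T.IsTransporterSystem p where
  obj_eq : T.obj = {P | F.IsCentric P}
  E_eq : ∀ P : SubgroupIn T.obj,
    T.E P = ((Subgroup.center P.sub).map (Subgroup.inclusion Subgroup.le_normalizer)).map (T.εAut P)

end TransporterData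

/-! ### `p`-local compact groups -/

/-- A `p`-local compact group `(S, F, L)` with Sylow subgroup `S`. -/
structure PLocalCompactGroup (p : ℕ) (S : Type u) [Group S] where
  toral : IsDiscretePToral p S
  F : FusionSystem S
  saturated : F.IsSaturated p
  L : TransporterData F
  linking : L.IsCentricLinkingSystem p

namespace PLocalCompactGroup

variable {p : ℕ} {S : Type u} [Group S] (𝒢 : PLocalCompactGroup p S)

/-- `S` as an object of the linking system. -/
def topL : SubgroupIn 𝒢.L.obj := ⟨⊤, 𝒢.linking.top_mem⟩

/-- `S` as an object of the centric orbit category. -/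
def topO : 𝒢.F.OrbitCat := ⟨⊤, by
  have h := 𝒢.linking.top_mem
  rw [𝒢.linking.obj_eq] at h
  exact h⟩

/-- The centre `Z(𝒢)`: the inverse limit of the centre functor over the centric orbit category. -/
noncomputable def centre : CommGrpCat.{u} := limit 𝒢.F.centerFunctor

/-- The structure map `ε_S : S → Aut_L(S)`. -/
def εTop : (⊤ : Subgroup S) →* Aut 𝒢.topL :=
  (𝒢.L.εAut 𝒢.topL).comp (Subgroup.inclusion Subgroup.le_normalizer)

/-- The canonical homomorphism `Z(𝒢) → Z(S) ≤ S → Aut_L(S)`. -/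
noncomputable def centreToAut : 𝒢.centre →* Aut 𝒢.topL :=
  (𝒢.εTop.comp (Subgroup.center (⊤ : Subgroup S)).subtype).comp
    (limit.π 𝒢.F.centerFunctor (Opposite.op 𝒢.topO)).hom

end PLocalCompactGroup

/-! ### Colimits of graphs of groups -/

section GraphColimit

variable {J : MultispanShape.{u, u}} (I : MultispanIndex J GrpCat.{u})

/-- The relations `fst n = snd n` in the free product of the vertex groups. -/
def graphRelations : Set (Monoid.CoprodI (fun b : J.R => I.right b)) :=
  {x | ∃ (a : J.L) (n : I.left a),
    x = (Monoid.CoprodI.of (M := fun b : J.R => I.right b) ((I.fst a).hom n)) *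
      (Monoid.CoprodI.of (M := fun b : J.R => I.right b) ((I.snd a).hom n))⁻¹}

/-- The free product of the vertex groups modulo the relations given by the edge groups. -/
abbrev GraphAmalgam : Type u :=
  Monoid.CoprodI (fun b : J.R => I.right b) ⧸ Subgroup.normalClosure (graphRelations I)

/-- The cocone exhibiting `GraphAmalgam` as a colimit. -/
def graphCocone : Multicofork I :=
  Multicofork.ofπ I (GrpCat.of (GraphAmalgam I))
    (fun b => GrpCat.ofHom ((QuotientGroup.mk' _).comp
      (Monoid.CoprodI.of (M := fun b : J.R => I.right b) (i := b)))) (by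
    intro a
    ext n
    refine (QuotientGroup.eq_iff_div_mem).2 ?_
    rw [div_eq_mul_inv]
    exact Subgroup.subset_normalClosure ⟨a, n, rfl⟩)

theorem graphCocone_lift_ker (K : Multicofork I) :
    Subgroup.normalClosure (graphRelations I) ≤
      (Monoid.CoprodI.lift (M := fun b : J.R => I.right b) (fun b => (K.π b).hom)).ker := by
  refine Subgroup.normalClosure_le_normal ?_
  rintro _ ⟨a, n, rfl⟩
  have h := congrArg (fun f => f.hom n) (K.condition a)
  change _ = 1
  rw [map_mul, map_inv, Monoid.CoprodI.lift_of, Monoid.CoprodI.lift_of, mul_inv_eq_one]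
  exact h

noncomputable def graphCocone_isColimit : IsColimit (graphCocone I) :=
  Multicofork.IsColimit.mk _
    (fun K => GrpCat.ofHom (QuotientGroup.lift _ _ (graphCocone_lift_ker I K)))
    (by
      intro K b
      ext x
      exact Monoid.CoprodI.lift_of (M := fun b : J.R => I.right b) (fun b => (K.π b).hom) x)
    (by
      intro K m hm
      ext1
      refine QuotientGroup.monoidHom_ext _ (Monoid.CoprodI.ext_hom _ _ fun b => ?_)
      ext x
      refine (congrArg (fun f => f.hom x) (hm b)).trans ?_
      exact (Monoid.CoprodI.lift_of (M := fun b : J.R => I.right b) (fun b => (K.π b).hom) x).symm)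

instance hasColimit_graph : HasColimit I.multispan := ⟨⟨⟨_, graphCocone_isColimit I⟩⟩⟩

end GraphColimit

/-! ### Robinson setups and Robinson amalgams -/

/-- A Robinson setup for `𝒢`: a fusion controlling family `fam` of objects of `L` and, for each
`P ∈ fam` with `P ≠ S`, a subgroup `N_P` of `L_P = Aut_L(P)`, with an embedding
`k_P : N_P → L_S = Aut_L(S)`, such that `N_S(P) ≤ N_P` compatibly with the embeddings of `N_S(P)`
in `Aut_L(P)` and in `Aut_L(S)`. -/
structure RobinsonSetup {p : ℕ} {S : Type u} [Group S] (𝒢 : PLocalCompactGroup p S) where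
  fam : Set (Subgroup S)
  controlling : 𝒢.F.IsFusionControlling p fam
  fam_subset : fam ⊆ 𝒢.L.obj
  N : ∀ P : SubgroupIn 𝒢.L.obj, P.sub ∈ fam → P.sub ≠ ⊤ → Subgroup (Aut P)
  k : ∀ (P : SubgroupIn 𝒢.L.obj) (hP : P.sub ∈ fam) (hS : P.sub ≠ ⊤), N P hP hS →* Aut 𝒢.topL
  k_injective : ∀ (P : SubgroupIn 𝒢.L.obj) (hP : P.sub ∈ fam) (hS : P.sub ≠ ⊤),
    Function.Injective (k P hP hS)
  normalizer_mem : ∀ (P : SubgroupIn 𝒢.L.obj) (hP : P.sub ∈ fam) (hS : P.sub ≠ ⊤)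
    (g : Subgroup.normalizer (P.sub : Set S)), 𝒢.L.εAut P g ∈ N P hP hS
  k_normalizer : ∀ (P : SubgroupIn 𝒢.L.obj) (hP : P.sub ∈ fam) (hS : P.sub ≠ ⊤)
    (g : Subgroup.normalizer (P.sub : Set S)),
    k P hP hS ⟨𝒢.L.εAut P g, normalizer_mem P hP hS g⟩ = 𝒢.εTop ⟨g, Subgroup.mem_top _⟩

namespace RobinsonSetup

variable {p : ℕ} {S : Type u} [Group S] {𝒢 : PLocalCompactGroup p S} (R : RobinsonSetup 𝒢)

/-- The vertices `v_P`, `P ∈ fam`, of the Robinson tree. -/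
abbrev Vertex : Type u := {P : SubgroupIn 𝒢.L.obj // P.sub ∈ R.fam}

/-- The edges `e_P`, `S ≠ P ∈ fam`, of the Robinson tree. -/
abbrev Edge : Type u := {P : SubgroupIn 𝒢.L.obj // P.sub ∈ R.fam ∧ P.sub ≠ ⊤}

/-- The vertex `v_S`. -/
def vTop : R.Vertex := ⟨𝒢.topL, R.controlling.top_mem⟩

/-- The Robinson tree: the edge `e_P` joins `v_S` with `v_P`. The associated category
`WalkingMultispan R.tree` has the vertices and edges as objects and, apart from identities, one
morphism from each edge to each of its two end points. -/
def tree : MultispanShape.{u, u} where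
  L := R.Edge
  R := R.Vertex
  fst := fun _ => R.vTop
  snd := fun e => ⟨e.1, e.2.1⟩

/-- The groups `L_P` on vertices and `N_P` on edges, with the maps
`k_P : N_P → L_S` and `j_P : N_P → L_P`. -/
def groups : MultispanIndex R.tree GrpCat.{u} where
  left := fun e : R.Edge => GrpCat.of (R.N e.1 e.2.1 e.2.2)
  right := fun v : R.Vertex => GrpCat.of (Aut v.1)
  fst := fun e : R.Edge => GrpCat.ofHom (R.k e.1 e.2.1 e.2.2)
  snd := fun e : R.Edge => GrpCat.ofHom (R.N e.1 e.2.1 e.2.2).subtype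

/-- The Robinson tree of groups, as a functor. -/
def treeOfGroups : WalkingMultispan R.tree ⥤ GrpCat.{u} := R.groups.multispan

instance : HasColimit R.treeOfGroups := hasColimit_graph R.groups

/-- The Robinson amalgam: the colimit of the Robinson tree of groups. -/
noncomputable def amalgam : GrpCat.{u} := colimit R.treeOfGroups

/-- The canonical homomorphism `L_P → G` for `P ∈ fam`. -/
noncomputable def ofVertex (v : R.Vertex) : Aut v.1 →* R.amalgam :=
  (colimit.ι R.treeOfGroups (WalkingMultispan.right v)).hom

/-- The canonical homomorphism `Z(𝒢) → Z(S) ≤ S → L_S → G`. -/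
noncomputable def centreToAmalgam : 𝒢.centre →* R.amalgam :=
  (R.ofVertex R.vTop).comp 𝒢.centreToAut

end RobinsonSetup

/-! An element of the centre of `𝒢` amounts to one element `z` of `Z(S)` that is fixed by every
morphism of `F` between centric subgroups. For `P` in the family, `L_P` acts on `ε(P)` through `ρ`
(`TransporterData.mul_εSelf`), so `ε_P(z)` is central in `L_P`. Since `z ∈ P ≤ N_S(P)`, the edge
relations identify `ε_P(z)` with `ε_S(z)`. Hence the image of `z` commutes with all vertex groups,
which generate the amalgam. The map is injective because vertex groups embed in the amalgam of a
tree of groups.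

Conversely, let `g` be central in the amalgam. The tree is a star, so the amalgam is the product
over `L_S` of the groups `L_S *_{N_P} L_P`. Normal forms show that central elements of an
amalgamated product lie in a factor (`Monoid.PushoutI.exists_of_mem_center`). Applied twice, this
puts `g` in some `L_P`. As `g` centralises `ε(P)`, it lies in `E(P) = ε(Z(P))`, and so it comes from
an element `z` of `S`. Commuting with the vertex groups means that `z ∈ Z(S)` and that `z` is fixed
by `Aut_F(P)` for each `P` in the family.

It remains to see that such a `z` is fixed by all morphisms between centric subgroups
(`FusionSystem.IsSaturated.fixes_of_isFusionControlling`). This is Alperin's fusion argument, but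
`S` may be infinite, and a descending induction on order is not available. Instead, among the images
`x ≠ z` of `z` under such morphisms, choose one whose centraliser `C = C_S(x)` has greatest order.
This is possible because the orders of the groups between `C_S(y)` and its normaliser are bounded
independently of `y` (`IsDiscretePToral.exists_bound_toralOrder`). Maximality makes every conjugate
of `C` an element centraliser and makes every proper overgroup of a conjugate fix `z`. The same
bound gives `C` a fully normalised conjugate. If this is radical, the family controls its
automorphisms; otherwise they extend to proper overgroups. Either way `z` is fixed on `C`, which
contradicts the existence of a morphism on `C` carrying `x` to `z`. -/

/-! ### Divisible abelian `p`-groups of finite rank -/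

/-- Divisible abelian `p`-groups with finitely many elements of order `p`. -/
structure IsPDivisible (p : ℕ) (D : Type*) [CommGroup D] : Prop where
  isPGroup : IsPGroup p D
  exists_root : ∀ x : D, ∃ y : D, y ^ p = x
  finite_socle : Finite (powMonoidHom p : D →* D).ker

theorem exists_pow_pow_eq {p : ℕ} {D : Type*} [Monoid D] (h : ∀ x : D, ∃ y : D, y ^ p = x)
    (n : ℕ) (x : D) : ∃ y : D, y ^ p ^ n = x := by
  induction n generalizing x with
  | zero => exact ⟨x, by simp⟩
  | succ n ih =>
    obtain ⟨y, rfl⟩ := h x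
    obtain ⟨w, rfl⟩ := ih y
    exact ⟨w, by rw [pow_succ, pow_mul]⟩

/-- Split `n` into a power of `p` and a part prime to `p`: the first is handled by divisibility, and
raising to the second is bijective on a cyclic `p`-group. -/
theorem IsPGroup.exists_pow_eq {p : ℕ} [hp : Fact p.Prime] {D : Type*} [Group D]
    (ht : IsPGroup p D) (h : ∀ x : D, ∃ y : D, y ^ p = x) {n : ℕ} (hn : n ≠ 0) (x : D) :
    ∃ y : D, y ^ n = x := by
  obtain ⟨a, m, hm, rfl⟩ := Nat.exists_eq_pow_mul_and_not_dvd hn p hp.out.ne_one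
  obtain ⟨y, rfl⟩ := exists_pow_pow_eq h a x
  obtain ⟨k, hk⟩ := IsPGroup.iff_orderOf.1 ht y
  have hc : Nat.Coprime m (orderOf y) := by
    rw [hk]
    exact (((Nat.Prime.coprime_iff_not_dvd hp.out).2 hm).symm).pow_right k
  obtain ⟨u, hu⟩ := exists_pow_eq_self_of_coprime hc
  refine ⟨y ^ u, ?_⟩
  rw [mul_comm, pow_mul, ← pow_mul y, mul_comm u, pow_mul, hu]

/-- Divisible abelian groups are injective, by Baer's criterion. -/
theorem IsPDivisible.exists_extension {p : ℕ} [Fact p.Prime] {D : Type*} [CommGroup D]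
    (hD : IsPDivisible p D) {A B : Type*} [CommGroup A] [CommGroup B] (i : A →* B)
    (hi : Function.Injective i) (f : A →* D) : ∃ g : B →* D, ∀ a, g (i a) = f a := by
  have hs : ∀ {n : ℕ}, n ≠ 0 → Function.Surjective (fun a : Additive D => n • a) :=
    fun {n} hn x => hD.isPGroup.exists_pow_eq hD.exists_root hn x.toMul
  let _ : DivisibleBy (Additive D) ℕ := divisibleByOfSMulRightSurj _ _ hs
  let _ : DivisibleBy (Additive D) ℤ := AddGroup.divisibleByIntOfDivisibleByNat _
  obtain ⟨g, hg⟩ := (Module.Baer.of_divisible (Additive D)).extension_property_addMonoidHom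
    (MonoidHom.toAdditive i) hi (MonoidHom.toAdditive f)
  exact ⟨MonoidHom.toAdditive.symm g, fun a => DFunLike.congr_fun hg a⟩

/-- A nontrivial kernel would contain an element of order `p`. -/
theorem IsPGroup.injective_of_socle {p : ℕ} {D E : Type*} [CommGroup D] [Group E]
    (ht : IsPGroup p D) (f : D →* E) (h : ∀ x : D, x ^ p = 1 → f x = 1 → x = 1) :
    Function.Injective f := by
  rw [injective_iff_map_eq_one]
  intro x hx
  obtain ⟨k, hk⟩ := ht x
  induction k with
  | zero => simpa using hk
  | succ k ih =>
    exact ih (h _ (by rw [← pow_mul, ← pow_succ, hk]) (by rw [map_pow, hx, one_pow]))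

theorem finite_ker_pow {p : ℕ} {D : Type*} [CommGroup D]
    (h : Finite (powMonoidHom p : D →* D).ker) (k : ℕ) :
    Finite (powMonoidHom (p ^ k) : D →* D).ker := by
  induction k with
  | zero =>
    have : (powMonoidHom (p ^ 0) : D →* D).ker = ⊥ := by
      ext x
      simp [MonoidHom.mem_ker]
    rw [this]
    infer_instance
  | succ k ih =>
    let g : (powMonoidHom (p ^ (k + 1)) : D →* D).ker →* (powMonoidHom p : D →* D).ker :=
      ((powMonoidHom (p ^ k)).comp (Subgroup.subtype _)).codRestrict _ (by
        rintro ⟨x, hx⟩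
        rw [MonoidHom.mem_ker] at hx ⊢
        simpa [← pow_mul, ← pow_succ] using hx)
    -- The `p^k`-th power map sends the `p^(k+1)`-torsion to the socle. Dividing by a chosen element
    -- of the same fibre lands in the `p^k`-torsion, so image and quotient together determine `x`.
    refine Finite.of_injective
      (β := (powMonoidHom p : D →* D).ker × (powMonoidHom (p ^ k) : D →* D).ker)
      (fun x => (g x, ⟨x * (Function.surjInv (f := g.rangeRestrict)
        g.rangeRestrict_surjective (g.rangeRestrict x))⁻¹, ?_⟩)) ?_
    · have h1 := Function.surjInv_eq g.rangeRestrict_surjective (g.rangeRestrict x)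
      generalize Function.surjInv g.rangeRestrict_surjective (g.rangeRestrict x) = y at h1
      have h2 : (y : D) ^ p ^ k = (x : D) ^ p ^ k :=
        congrArg (fun t : g.range => (t.1 : D)) h1
      rw [MonoidHom.mem_ker]
      simp [mul_pow, h2]
    · intro x y hxy
      simp only [Prod.mk.injEq, Subtype.mk.injEq] at hxy
      have h1 : g.rangeRestrict x = g.rangeRestrict y := Subtype.ext hxy.1
      have h2 := hxy.2
      rw [h1] at h2
      exact Subtype.ext (mul_right_cancel h2)

/-- The group is the union of its finite `p^k`-torsion subgroups, each of which `f` maps to itself.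
-/
theorem IsPDivisible.surjective_of_injective {p : ℕ} {D : Type*} [CommGroup D]
    (hD : IsPDivisible p D) (f : D →* D) (hf : Function.Injective f) : Function.Surjective f := by
  intro x
  obtain ⟨k, hk⟩ := hD.isPGroup x
  have := finite_ker_pow hD.finite_socle k
  let g : (powMonoidHom (p ^ k) : D →* D).ker → (powMonoidHom (p ^ k) : D →* D).ker :=
    fun y => ⟨f y, by
      have := y.2
      rw [MonoidHom.mem_ker] at this ⊢
      simp only [powMonoidHom_apply] at this ⊢
      rw [← map_pow, this, map_one]⟩
  have hg : Function.Injective g := fun a b hab =>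
    Subtype.ext (hf (congrArg Subtype.val hab))
  obtain ⟨y, hy⟩ := Finite.surjective_of_injective hg ⟨x, hk⟩
  exact ⟨y, congrArg Subtype.val hy⟩

theorem nonempty_mulEquiv_of_pow_prime_eq_one {p : ℕ} [Fact p.Prime] {A B : Type*} [CommGroup A]
    [CommGroup B] [Finite A] [Finite B] (hA : ∀ x : A, x ^ p = 1) (hB : ∀ x : B, x ^ p = 1)
    (h : Nat.card A = Nat.card B) : Nonempty (A ≃* B) := by
  let _ : Module (ZMod p) (Additive A) := AddCommGroup.zmodModule (n := p) (fun x => hA x.toMul)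
  let _ : Module (ZMod p) (Additive B) := AddCommGroup.zmodModule (n := p) (fun x => hB x.toMul)
  have hA' : Nat.card (Additive A) = p ^ Module.finrank (ZMod p) (Additive A) := by
    rw [Module.natCard_eq_pow_finrank (K := ZMod p), Nat.card_zmod]
  have hB' : Nat.card (Additive B) = p ^ Module.finrank (ZMod p) (Additive B) := by
    rw [Module.natCard_eq_pow_finrank (K := ZMod p), Nat.card_zmod]
  have hfr : Module.finrank (ZMod p) (Additive A) = Module.finrank (ZMod p) (Additive B) := by
    refine Nat.pow_right_injective (Fact.out : p.Prime).two_le ?_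
    simp only
    rw [← hA', ← hB']
    exact h
  exact ⟨MulEquiv.toAdditive.symm (LinearEquiv.ofFinrankEq _ _ hfr).toAddEquiv⟩

/-- Mutually inverse isomorphisms of the socles extend to `f` and `g` by injectivity of the targets.
Both are injective on socles, hence injective. Then `f ∘ g` is an injective endomorphism, hence
surjective, and so is `f`. -/
theorem IsPDivisible.nonempty_mulEquiv {p : ℕ} [Fact p.Prime] {D E : Type*} [CommGroup D]
    [CommGroup E] (hD : IsPDivisible p D) (hE : IsPDivisible p E)
    (h : Nat.card (powMonoidHom p : D →* D).ker = Nat.card (powMonoidHom p : E →* E).ker) :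
    Nonempty (D ≃* E) := by
  have := hD.finite_socle
  have := hE.finite_socle
  obtain ⟨e⟩ := nonempty_mulEquiv_of_pow_prime_eq_one (p := p)
    (A := (powMonoidHom p : D →* D).ker) (B := (powMonoidHom p : E →* E).ker)
    (fun x => Subtype.ext x.2) (fun x => Subtype.ext x.2) h
  obtain ⟨f, hf⟩ := hE.exists_extension (Subgroup.subtype _) Subtype.val_injective
    ((Subgroup.subtype _).comp e.toMonoidHom)
  obtain ⟨g, hg⟩ := hD.exists_extension (Subgroup.subtype _) Subtype.val_injective
    ((Subgroup.subtype _).comp e.symm.toMonoidHom)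
  have hfi : Function.Injective f := hD.isPGroup.injective_of_socle f fun x hx hfx => by
    have h1 := (hf ⟨x, hx⟩).symm.trans hfx
    have h2 : e ⟨x, hx⟩ = 1 := Subtype.ext h1
    exact congrArg Subtype.val ((map_eq_one_iff e e.injective).1 h2)
  have hgi : Function.Injective g := hE.isPGroup.injective_of_socle g fun x hx hfx => by
    have h1 := (hg ⟨x, hx⟩).symm.trans hfx
    have h2 : e.symm ⟨x, hx⟩ = 1 := Subtype.ext h1
    exact congrArg Subtype.val ((map_eq_one_iff e.symm e.symm.injective).1 h2)
  have hs := hE.surjective_of_injective (f.comp g) (hfi.comp hgi)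
  refine ⟨MulEquiv.ofBijective f ⟨hfi, fun y => ?_⟩⟩
  obtain ⟨x, hx⟩ := hs y
  exact ⟨g x, hx⟩

theorem card_socle_prufer (p : ℕ) [hp : Fact p.Prime] (r : ℕ) :
    Nat.card (powMonoidHom p : (Fin r → PruferGroup p) →* _).ker = p ^ r := by
  let e : (powMonoidHom p : (Fin r → PruferGroup p) →* _).ker ≃ (Fin r → rootsOfUnity p ℂ) :=
    { toFun := fun f i => ⟨(f.1 i).1, by
        rw [mem_rootsOfUnity]
        exact congrArg Subtype.val (congrFun f.2 i)⟩
      invFun := fun g => ⟨fun i => ⟨(g i).1, CommGroup.mem_primaryComponent.2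
          ⟨1, by rw [pow_one]; exact (g i).2⟩⟩, by
        rw [MonoidHom.mem_ker]
        funext i
        exact Subtype.ext (g i).2⟩
      left_inv := fun f => rfl
      right_inv := fun g => rfl }
  have : NeZero p := ⟨hp.out.ne_zero⟩
  rw [Nat.card_congr e, Nat.card_fun,
    Complex.card_rootsOfUnity]
  simp

theorem isPDivisible_prufer (p : ℕ) [hp : Fact p.Prime] (r : ℕ) :
    IsPDivisible p (Fin r → PruferGroup p) where
  isPGroup := by
    intro x
    choose k hk using fun i => CommGroup.mem_primaryComponent.1 (x i).2
    refine ⟨∑ i, k i, funext fun i => Subtype.ext ?_⟩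
    obtain ⟨d, hd⟩ := pow_dvd_pow p (Finset.single_le_sum (f := k) (fun _ _ => Nat.zero_le _)
      (Finset.mem_univ i))
    change ((x i : ℂˣ)) ^ p ^ (∑ i, k i) = 1
    rw [hd, pow_mul, hk, one_pow]
  exists_root := by
    intro x
    have h : ∀ a : PruferGroup p, ∃ b : PruferGroup p, b ^ p = a := by
      rintro ⟨a, ha⟩
      obtain ⟨c, hc⟩ := IsAlgClosed.exists_pow_nat_eq (a : ℂ) hp.out.pos
      have hc0 : c ≠ 0 := by
        rintro rfl
        rw [zero_pow hp.out.ne_zero] at hc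
        exact a.ne_zero hc.symm
      have hca : Units.mk0 c hc0 ^ p = a := Units.ext (by simpa using hc)
      obtain ⟨k, hk⟩ := CommGroup.mem_primaryComponent.1 ha
      exact ⟨⟨Units.mk0 c hc0, CommGroup.mem_primaryComponent.2
        ⟨k + 1, by rw [pow_succ', pow_mul, hca, hk]⟩⟩, Subtype.ext hca⟩
    choose y hy using fun i => h (x i)
    exact ⟨y, funext hy⟩
  finite_socle := by
    refine Nat.finite_of_card_ne_zero ?_
    rw [card_socle_prufer]
    exact pow_ne_zero _ hp.out.ne_zero

theorem IsPDivisible.exists_mulEquiv_prufer {p : ℕ} [Fact p.Prime] {D : Type*} [CommGroup D]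
    (hD : IsPDivisible p D) : ∃ s : ℕ, Nonempty (D ≃* (Fin s → PruferGroup p)) := by
  have := hD.finite_socle
  obtain ⟨s, hs⟩ := IsPGroup.iff_card.1 (hD.isPGroup.to_subgroup (powMonoidHom p : D →* D).ker)
  exact ⟨s, hD.nonempty_mulEquiv (isPDivisible_prufer p s) (by rw [hs, card_socle_prufer])⟩

/-! ### Subgroups of discrete `p`-toral groups -/

section Toral

variable {p : ℕ} {S : Type*} [Group S]

/-- The properties of a discrete `p`-torus, for a subgroup of a possibly nonabelian group. -/
structure IsTorusSubgroup (p : ℕ) (D : Subgroup S) : Prop where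
  comm : ∀ x ∈ D, ∀ y ∈ D, x * y = y * x
  tors : ∀ x ∈ D, ∃ k : ℕ, x ^ p ^ k = 1
  exists_root : ∀ x ∈ D, ∃ y ∈ D, y ^ p = x
  finite_socle : {x : S | x ∈ D ∧ x ^ p = 1}.Finite

theorem IsTorusSubgroup.isPGroup {D : Subgroup S} (hD : IsTorusSubgroup p D) : IsPGroup p D :=
  fun x => (hD.tors x x.2).imp fun _ hk => Subtype.ext hk

theorem IsTorusSubgroup.exists_pow_eq [Fact p.Prime] {D : Subgroup S} (hD : IsTorusSubgroup p D)
    {n : ℕ} (hn : n ≠ 0) {x : S} (hx : x ∈ D) : ∃ y ∈ D, y ^ n = x := by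
  obtain ⟨y, hy⟩ := hD.isPGroup.exists_pow_eq (fun x => by
    obtain ⟨y, hy, hyx⟩ := hD.exists_root x x.2
    exact ⟨⟨y, hy⟩, Subtype.ext hyx⟩) hn ⟨x, hx⟩
  exact ⟨y, y.2, congrArg Subtype.val hy⟩

theorem isTorusSubgroup_of_mulEquiv [Fact p.Prime] {D : Subgroup S} {r : ℕ}
    (e : D ≃* (Fin r → PruferGroup p)) :
    IsTorusSubgroup p D ∧ {x : S | x ∈ D ∧ x ^ p = 1}.ncard = p ^ r := by
  have hA := isPDivisible_prufer p r
  let f : {x : S | x ∈ D ∧ x ^ p = 1} ≃ (powMonoidHom p : (Fin r → PruferGroup p) →* _).ker :=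
    { toFun := fun x => ⟨e ⟨x, x.2.1⟩, by
        rw [MonoidHom.mem_ker, powMonoidHom_apply, ← map_pow, map_eq_one_iff e e.injective]
        exact Subtype.ext x.2.2⟩
      invFun := fun y => ⟨e.symm y, (e.symm y).2, by
        rw [← Subgroup.coe_pow, ← map_pow]
        have : y.1 ^ p = 1 := y.2
        rw [this, map_one, Subgroup.coe_one]⟩
      left_inv := fun x => by simp
      right_inv := fun y => by simp }
  refine ⟨⟨fun x hx y hy => ?_, fun x hx => ?_, fun x hx => ?_, ?_⟩, ?_⟩
  · have : (⟨x, hx⟩ : D) * ⟨y, hy⟩ = ⟨y, hy⟩ * ⟨x, hx⟩ := by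
      apply e.injective
      rw [map_mul, map_mul, mul_comm]
    exact congrArg Subtype.val this
  · obtain ⟨k, hk⟩ := hA.isPGroup (e ⟨x, hx⟩)
    rw [← map_pow, map_eq_one_iff e e.injective] at hk
    exact ⟨k, congrArg Subtype.val hk⟩
  · obtain ⟨y, hy⟩ := hA.exists_root (e ⟨x, hx⟩)
    refine ⟨e.symm y, (e.symm y).2, ?_⟩
    rw [← Subgroup.coe_pow, ← map_pow, hy, e.symm_apply_apply]
  · have := hA.finite_socle
    have := Finite.of_equiv _ f.symm
    exact Set.toFinite _
  · rw [← Nat.card_coe_set_eq, Nat.card_congr f, card_socle_prufer]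

theorem IsTorusSubgroup.finite_torsion {D : Subgroup S} (hD : IsTorusSubgroup p D) (k : ℕ) :
    {x : S | x ∈ D ∧ x ^ p ^ k = 1}.Finite := by
  let _ : CommGroup D := { (inferInstance : Group D) with
    mul_comm := fun x y => Subtype.ext (hD.comm x x.2 y y.2) }
  have h1 : Finite (powMonoidHom p : D →* D).ker := by
    have := hD.finite_socle.to_subtype
    refine Finite.of_injective (β := {x : S | x ∈ D ∧ x ^ p = 1})
      (fun x => ⟨x.1.1, x.1.2, congrArg Subtype.val x.2⟩) fun x y h => ?_
    exact Subtype.ext (Subtype.ext (congrArg (fun t => t.1) h))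
  have h2 := finite_ker_pow h1 k
  refine (Set.finite_range (fun x : (powMonoidHom (p ^ k) : D →* D).ker => ((x : D) : S))).subset ?_
  rintro x ⟨hx, hxk⟩
  exact ⟨⟨⟨x, hx⟩, Subtype.ext hxk⟩, rfl⟩

theorem IsTorusSubgroup.exists_mulEquiv [Fact p.Prime] {D : Subgroup S}
    (hD : IsTorusSubgroup p D) : ∃ s : ℕ, Nonempty (D ≃* (Fin s → PruferGroup p)) := by
  let _ : CommGroup D := { (inferInstance : Group D) with
    mul_comm := fun x y => Subtype.ext (hD.comm x x.2 y y.2) }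
  refine IsPDivisible.exists_mulEquiv_prufer (p := p) (D := D) ⟨hD.isPGroup, fun x => ?_, ?_⟩
  · obtain ⟨y, hy, hyx⟩ := hD.exists_root x x.2
    exact ⟨⟨y, hy⟩, Subtype.ext hyx⟩
  · have := hD.finite_socle.to_subtype
    refine Finite.of_injective (β := {x : S | x ∈ D ∧ x ^ p = 1})
      (fun x => ⟨x.1.1, x.1.2, congrArg Subtype.val x.2⟩) fun x y h => ?_
    exact Subtype.ext (Subtype.ext (congrArg (fun t => t.1) h))

/-! ### Uniqueness and monotonicity of the toral order -/

theorem HasToralOrder.of_mulEquiv {P Q : Type*} [Group P] [Group Q] (e : P ≃* Q) {r m : ℕ}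
    (h : HasToralOrder p P r m) : HasToralOrder p Q r m := by
  obtain ⟨T, hT, ⟨f⟩, hm, ha⟩ := h
  refine ⟨T.map e.toMonoidHom, hT.map _ e.surjective,
    ⟨(T.equivMapOfInjective e.toMonoidHom e.injective).symm.trans f⟩, ?_, ha⟩
  rw [← hm]
  exact Subgroup.index_map_equiv T e

theorem hasToralOrder_iff {H : Subgroup S} {r m : ℕ} :
    HasToralOrder p H r m ↔ ∃ D : Subgroup S, D ≤ H ∧ H ≤ Subgroup.normalizer (D : Set S) ∧
      Nonempty (D ≃* (Fin r → PruferGroup p)) ∧ D.relIndex H = m ∧ ∃ a : ℕ, m = p ^ a := by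
  constructor
  · rintro ⟨T, hT, ⟨e⟩, hm, ha⟩
    have hle : T.map H.subtype ≤ H := Subgroup.map_subtype_le T
    have hsub : (T.map H.subtype).subgroupOf H = T :=
      Subgroup.comap_map_eq_self_of_injective H.subtype_injective T
    refine ⟨T.map H.subtype, hle, ?_,
      ⟨(T.equivMapOfInjective H.subtype H.subtype_injective).symm.trans e⟩, ?_, ha⟩
    · rw [← Subgroup.normal_subgroupOf_iff_le_normalizer hle, hsub]
      exact hT
    · rw [Subgroup.relIndex, hsub, hm]
  · rintro ⟨D, hle, hn, ⟨e⟩, hm, ha⟩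
    exact ⟨D.subgroupOf H, (Subgroup.normal_subgroupOf_iff_le_normalizer hle).2 hn,
      ⟨(Subgroup.subgroupOfEquivOfLe hle).trans e⟩, hm, ha⟩

/-- A divisible abelian group has no proper subgroup of finite index, so `D` equals `D ∩ E`. -/
theorem IsTorusSubgroup.le_of_relIndex_ne_zero [Fact p.Prime] {D E H : Subgroup S}
    (hD : IsTorusSubgroup p D) (hDH : D ≤ H) (h0 : E.relIndex H ≠ 0) : D ≤ E := by
  intro x hx
  have h1 : E.relIndex D ≠ 0 := fun h => h0 (Subgroup.relIndex_eq_zero_of_le_right hDH h)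
  obtain ⟨y, hy, rfl⟩ := hD.exists_pow_eq h1 hx
  have : (E.subgroupOf D).Normal := ⟨fun n hn g => by
    have hc : g * n = n * g := Subtype.ext (hD.comm g g.2 n n.2)
    have : g * n * g⁻¹ = n := by
      rw [hc, mul_inv_cancel_right]
    rwa [this]⟩
  have h2 := Subgroup.pow_index_mem (E.subgroupOf D) (⟨y, hy⟩ : D)
  exact Subgroup.mem_subgroupOf.1 h2

/-- The torus of `H` lies in that of `K`, and socles compare the ranks. For equal ranks the two tori
coincide, and the indices over the common torus differ by the factor `[K : H]`. -/
theorem toralOrder_le_of_le [hp : Fact p.Prime] {H K : Subgroup S} (h : H ≤ K) {r m s n : ℕ}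
    (hH : HasToralOrder p H r m) (hK : HasToralOrder p K s n) :
    r < s ∨ (r = s ∧ m ≤ n ∧ (m = n → H = K)) := by
  obtain ⟨D, hDH, -, ⟨e⟩, hm, -⟩ := hasToralOrder_iff.1 hH
  obtain ⟨E, hEK, -, ⟨f⟩, hn, b, hb⟩ := hasToralOrder_iff.1 hK
  obtain ⟨hD, hDr⟩ := isTorusSubgroup_of_mulEquiv e
  obtain ⟨hE, hEs⟩ := isTorusSubgroup_of_mulEquiv f
  have hn0 : n ≠ 0 := by
    rw [hb]
    exact pow_ne_zero _ hp.out.ne_zero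
  have hDE : D ≤ E := hD.le_of_relIndex_ne_zero (hDH.trans h) (hn ▸ hn0)
  have hsub : {x : S | x ∈ D ∧ x ^ p = 1} ⊆ {x : S | x ∈ E ∧ x ^ p = 1} :=
    fun x hx => ⟨hDE hx.1, hx.2⟩
  have hle := Set.ncard_le_ncard hsub hE.finite_socle
  rw [hDr, hEs] at hle
  have hrs : r ≤ s := (Nat.pow_le_pow_iff_right hp.out.one_lt).1 hle
  rcases hrs.lt_or_eq with hlt | rfl
  · exact Or.inl hlt
  refine Or.inr ⟨rfl, ?_⟩
  have heq := Set.eq_of_subset_of_ncard_le hsub (by rw [hDr, hEs]) hE.finite_socle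
  -- Equal socles force equal tori: `x ^ p ^ k` lies in the socle, hence in `D`. Dividing `x` by a
  -- `p^k`-th root of it in `D` lowers the exponent.
  have hED : E ≤ D := by
    have key : ∀ k : ℕ, ∀ x ∈ E, x ^ p ^ k = 1 → x ∈ D := by
      intro k
      induction k with
      | zero =>
        intro x _ hx
        rw [pow_zero, pow_one] at hx
        rw [hx]
        exact D.one_mem
      | succ k ih =>
        intro x hxE hx
        have h1 : x ^ p ^ k ∈ {x : S | x ∈ E ∧ x ^ p = 1} :=
          ⟨E.pow_mem hxE _, by rw [← pow_mul, ← pow_succ, hx]⟩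
        rw [← heq] at h1
        obtain ⟨y, hy, hyx⟩ := hD.exists_pow_eq (pow_ne_zero k hp.out.ne_zero) h1.1
        have hc : Commute x y⁻¹ := hE.comm x hxE _ (E.inv_mem (hDE hy))
        have h2 : x * y⁻¹ ∈ D := ih _ (E.mul_mem hxE (E.inv_mem (hDE hy))) (by
          rw [hc.mul_pow, inv_pow, hyx, mul_inv_cancel])
        simpa using D.mul_mem h2 hy
    intro x hx
    obtain ⟨k, hk⟩ := hE.tors x hx
    exact key k x hx hk
  obtain rfl : D = E := le_antisymm hDE hED
  have hmul := Subgroup.relIndex_mul_relIndex D H K hDH h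
  rw [hm, hn] at hmul
  constructor
  · exact Nat.le_of_dvd (Nat.pos_of_ne_zero hn0) ⟨_, hmul.symm⟩
  · rintro rfl
    have h1 : H.relIndex K = 1 := by
      exact Nat.eq_of_mul_eq_mul_left (Nat.pos_of_ne_zero hn0) (by rw [hmul, mul_one])
    exact le_antisymm h (Subgroup.relIndex_eq_one.1 h1)

theorem toralOrder_unique [Fact p.Prime] {H : Subgroup S} {r m s n : ℕ}
    (h : HasToralOrder p H r m) (h' : HasToralOrder p H s n) : r = s ∧ m = n := by
  rcases toralOrder_le_of_le le_rfl h h' with h1 | ⟨h1, h2, -⟩ <;>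
  rcases toralOrder_le_of_le le_rfl h' h with h3 | ⟨h3, h4, -⟩ <;> omega

/-! ### Tori in subgroups, and the normaliser condition -/

theorem IsDiscretePToral.exists_torus [Fact p.Prime] (hS : IsDiscretePToral p S) :
    ∃ T : Subgroup S, T.Normal ∧ IsTorusSubgroup p T ∧ T.index ≠ 0 ∧ (∃ a, T.index = p ^ a) ∧
      IsPGroup p S := by
  obtain ⟨r, m, T, hT, ⟨e⟩, hm, a, ha⟩ := hS
  have hTor := (isTorusSubgroup_of_mulEquiv e).1
  refine ⟨T, hT, hTor, ?_, ⟨a, hm.trans ha⟩, fun x => ?_⟩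
  · rw [hm, ha]
    exact pow_ne_zero _ (Fact.out : p.Prime).ne_zero
  · have h1 := T.pow_index_mem x
    obtain ⟨k, hk⟩ := hTor.tors _ h1
    refine ⟨a + k, ?_⟩
    rw [pow_add, pow_mul, ← ha, ← hm, hk]

/-- The subgroup of `n`-th powers of a commutative subgroup. -/
def powSubgroup (A : Subgroup S) (hA : ∀ x ∈ A, ∀ y ∈ A, x * y = y * x) (n : ℕ) : Subgroup S where
  carrier := {x | ∃ a ∈ A, a ^ n = x}
  one_mem' := ⟨1, A.one_mem, one_pow n⟩
  mul_mem' := by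
    rintro _ _ ⟨a, ha, rfl⟩ ⟨b, hb, rfl⟩
    exact ⟨a * b, A.mul_mem ha hb, Commute.mul_pow (hA a ha b hb) n⟩
  inv_mem' := by
    rintro _ ⟨a, ha, rfl⟩
    exact ⟨a⁻¹, A.inv_mem ha, inv_pow a n⟩

/-- The socles of the subgroups of `p^n`-th powers form a decreasing chain of finite sets. Once the
chain is stable, the subgroup of `p^n`-th powers is divisible. -/
theorem exists_isTorusSubgroup_le [hp : Fact p.Prime] (A : Subgroup S)
    (hA : ∀ x ∈ A, ∀ y ∈ A, x * y = y * x) (ht : ∀ x ∈ A, ∃ k : ℕ, x ^ p ^ k = 1)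
    (hf : ∀ k : ℕ, {x : S | x ∈ A ∧ x ^ p ^ k = 1}.Finite) :
    ∃ n : ℕ, IsTorusSubgroup p (powSubgroup A hA (p ^ n)) ∧
      (powSubgroup A hA (p ^ n)).relIndex A ≠ 0 := by
  let X : ℕ → Set S := fun n => {x | x ∈ powSubgroup A hA (p ^ n) ∧ x ^ p = 1}
  have hle : ∀ n, powSubgroup A hA (p ^ n) ≤ A := by
    rintro n _ ⟨a, ha, rfl⟩
    exact A.pow_mem ha _
  have hanti : ∀ n k, powSubgroup A hA (p ^ (n + k)) ≤ powSubgroup A hA (p ^ n) := by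
    rintro n k _ ⟨a, ha, rfl⟩
    exact ⟨a ^ p ^ k, A.pow_mem ha _, by rw [← pow_mul, pow_add, mul_comm]⟩
  have hXfin : ∀ n, (X n).Finite := fun n =>
    (hf 1).subset fun x hx => ⟨hle n hx.1, by simpa using hx.2⟩
  obtain ⟨n, hn⟩ : ∃ n, ∀ k, (X n).ncard ≤ (X k).ncard := by
    obtain ⟨n, hn⟩ := Nat.sInf_mem (Set.range_nonempty fun n => (X n).ncard)
    exact ⟨n, fun k => hn.le.trans (Nat.sInf_le ⟨k, rfl⟩)⟩
  have hstab : ∀ k x, x ∈ powSubgroup A hA (p ^ n) → x ^ p = 1 →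
      x ∈ powSubgroup A hA (p ^ (n + k)) := by
    intro k x hx hxp
    have h1 : X (n + k) ⊆ X n := fun y hy => ⟨hanti n k hy.1, hy.2⟩
    have h2 := Set.eq_of_subset_of_ncard_le h1 (hn _) (hXfin n)
    have h3 : x ∈ X n := ⟨hx, hxp⟩
    rw [← h2] at h3
    exact h3.1
  have hroot : ∀ x ∈ powSubgroup A hA (p ^ n), ∃ y ∈ powSubgroup A hA (p ^ n), y ^ p = x := by
    have key : ∀ j : ℕ, ∀ x ∈ powSubgroup A hA (p ^ n), x ^ p ^ j = 1 →
        ∃ y ∈ powSubgroup A hA (p ^ n), y ^ p = x := by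
      intro j
      induction j with
      | zero =>
        intro x _ hx
        rw [pow_zero, pow_one] at hx
        exact ⟨1, Subgroup.one_mem _, by rw [hx, one_pow]⟩
      | succ j ih =>
        intro x hx hxj
        -- By stability the socle element `x ^ p ^ j` is a `p^(n+j+1)`-th power. So it is the
        -- `p^j`-th power of `c ^ p` with `c = a ^ p ^ n`, and `x * (c ^ p)⁻¹` has smaller exponent.
        obtain ⟨a, ha, hax⟩ := hstab (j + 1) (x ^ p ^ j) (Subgroup.pow_mem _ hx _)
          (by rw [← pow_mul, ← pow_succ, hxj])
        have hcm : a ^ p ^ n ∈ powSubgroup A hA (p ^ n) := ⟨a, ha, rfl⟩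
        set c := a ^ p ^ n with hc
        have hcx : (c ^ p) ^ p ^ j = x ^ p ^ j := by
          rw [← hax, hc, ← pow_mul, ← pow_mul, pow_add, pow_succ']
        have hcomm : Commute x (c ^ p)⁻¹ :=
          hA x (hle n hx) _ (A.inv_mem (A.pow_mem (hle n hcm) _))
        obtain ⟨y, hy, hyx⟩ := ih (x * (c ^ p)⁻¹)
          (Subgroup.mul_mem _ hx (Subgroup.inv_mem _ (Subgroup.pow_mem _ hcm _)))
          (by rw [hcomm.mul_pow, inv_pow, hcx, mul_inv_cancel])
        refine ⟨y * c, Subgroup.mul_mem _ hy hcm, ?_⟩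
        rw [Commute.mul_pow (hA y (hle n hy) c (hle n hcm)), hyx, inv_mul_cancel_right]
    intro x hx
    obtain ⟨k, hk⟩ := ht x (hle n hx)
    exact key k x hx hk
  have hT : IsTorusSubgroup p (powSubgroup A hA (p ^ n)) :=
    ⟨fun x hx y hy => hA x (hle n hx) y (hle n hy), fun x hx => ht x (hle n hx), hroot, hXfin n⟩
  refine ⟨n, hT, ?_⟩
  -- The finitely many elements of exponent `p^n` meet every coset: divide `a` by a `p^n`-th root,
  -- in the torus, of `a ^ p ^ n`.
  have hfin : Finite (A ⧸ (powSubgroup A hA (p ^ n)).subgroupOf A) := by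
    have := (hf n).to_subtype
    refine Finite.of_surjective (α := {x : S | x ∈ A ∧ x ^ p ^ n = 1})
      (fun x => QuotientGroup.mk ⟨x.1, x.2.1⟩) fun q => ?_
    obtain ⟨⟨a, ha⟩, rfl⟩ := QuotientGroup.mk_surjective q
    obtain ⟨d, hd, hda⟩ := hT.exists_pow_eq (pow_ne_zero n hp.out.ne_zero)
      (show a ^ p ^ n ∈ powSubgroup A hA (p ^ n) from ⟨a, ha, rfl⟩)
    have hcomm : Commute a d⁻¹ := hA a ha _ (A.inv_mem (hle n hd))
    refine ⟨⟨a * d⁻¹, A.mul_mem ha (A.inv_mem (hle n hd)), ?_⟩, ?_⟩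
    · rw [hcomm.mul_pow, inv_pow, hda, mul_inv_cancel]
    · rw [QuotientGroup.eq, Subgroup.mem_subgroupOf]
      simpa using hd
  exact Subgroup.index_ne_zero_of_finite

theorem hasToralOrder_of_isTorusSubgroup [Fact p.Prime] {D H : Subgroup S} (hS : IsPGroup p S)
    (hD : IsTorusSubgroup p D) (hDH : D ≤ H) (hn : H ≤ Subgroup.normalizer (D : Set S))
    (h0 : D.relIndex H ≠ 0) : ∃ r, HasToralOrder p H r (D.relIndex H) := by
  obtain ⟨s, hs⟩ := hD.exists_mulEquiv
  refine ⟨s, hasToralOrder_iff.2 ⟨D, hDH, hn, hs, rfl, ?_⟩⟩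
  have hnor : (D.subgroupOf H).Normal := (Subgroup.normal_subgroupOf_iff_le_normalizer hDH).2 hn
  have : (D.subgroupOf H).FiniteIndex := ⟨h0⟩
  have hq : IsPGroup p (H ⧸ D.subgroupOf H) := (hS.to_subgroup H).to_quotient _
  obtain ⟨a, ha⟩ := IsPGroup.iff_card.1 hq
  exact ⟨a, ha⟩

/-- A sufficiently high power subgroup of the abelian group `H ∩ T` is a torus. It is stable under
`H` because `T` is normal in `S`, and it has finite index because `T` does. -/
theorem IsDiscretePToral.exists_hasToralOrder [Fact p.Prime] (hS : IsDiscretePToral p S)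
    (H : Subgroup S) : ∃ r m, HasToralOrder p H r m := by
  obtain ⟨T, hTn, hT, hT0, -, hSp⟩ := hS.exists_torus
  have hA : ∀ x ∈ H ⊓ T, ∀ y ∈ H ⊓ T, x * y = y * x := fun x hx y hy => hT.comm x hx.2 y hy.2
  obtain ⟨n, hD, hD0⟩ := exists_isTorusSubgroup_le (p := p) (H ⊓ T) hA
    (fun x hx => hT.tors x hx.2)
    (fun k => (hT.finite_torsion k).subset fun x hx => ⟨hx.1.2, hx.2⟩)
  have hle : powSubgroup (H ⊓ T) hA (p ^ n) ≤ H ⊓ T := by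
    rintro _ ⟨a, ha, rfl⟩
    exact Subgroup.pow_mem _ ha _
  have hconj : ∀ g ∈ H, ∀ x ∈ powSubgroup (H ⊓ T) hA (p ^ n),
      g * x * g⁻¹ ∈ powSubgroup (H ⊓ T) hA (p ^ n) := by
    rintro g hg _ ⟨a, ha, rfl⟩
    exact ⟨g * a * g⁻¹, ⟨H.mul_mem (H.mul_mem hg ha.1) (H.inv_mem hg), hTn.conj_mem a ha.2 g⟩,
      conj_pow⟩
  obtain ⟨r, hr⟩ := hasToralOrder_of_isTorusSubgroup hSp hD (hle.trans inf_le_left) (by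
    intro g hg
    rw [Subgroup.mem_normalizer_iff]
    refine fun x => ⟨hconj g hg x, fun hx => ?_⟩
    simpa [mul_assoc] using hconj g⁻¹ (H.inv_mem hg) _ hx) (by
    rw [← Subgroup.relIndex_mul_relIndex _ _ _ hle inf_le_left]
    refine mul_ne_zero hD0 ?_
    rw [Subgroup.inf_relIndex_left]
    exact fun h => hT0 (Nat.eq_zero_of_zero_dvd (h ▸ Subgroup.relIndex_dvd_index_of_normal T H)))
  exact ⟨r, _, hr⟩

/-- The tori of `H` and `K` have finite index and so contain each other; only the index over the
torus changes. -/
theorem IsDiscretePToral.hasToralOrder_of_relIndex_ne_zero [Fact p.Prime]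
    (hS : IsDiscretePToral p S) {H K : Subgroup S} (h : H ≤ K) (h0 : H.relIndex K ≠ 0) {r m : ℕ}
    (hH : HasToralOrder p H r m) : HasToralOrder p K r (m * H.relIndex K) := by
  obtain ⟨s, n, hK⟩ := hS.exists_hasToralOrder K
  obtain ⟨D, hDH, -, ⟨e⟩, hm, a, ha⟩ := hasToralOrder_iff.1 hH
  obtain ⟨E, hEK, hEn, ⟨f⟩, hn, b, hb⟩ := hasToralOrder_iff.1 hK
  have hp0 : p ≠ 0 := (Fact.out : p.Prime).ne_zero
  have hD := (isTorusSubgroup_of_mulEquiv e).1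
  have hE := (isTorusSubgroup_of_mulEquiv f).1
  have hDE : D ≤ E := hD.le_of_relIndex_ne_zero (hDH.trans h)
    (by rw [hn, hb]; exact pow_ne_zero _ hp0)
  have hED : E ≤ D := hE.le_of_relIndex_ne_zero (hE.le_of_relIndex_ne_zero hEK h0)
    (by rw [hm, ha]; exact pow_ne_zero _ hp0)
  obtain rfl : D = E := le_antisymm hDE hED
  have hmul := Subgroup.relIndex_mul_relIndex D H K hDH h
  rw [hm] at hmul
  exact hasToralOrder_iff.2 ⟨D, hEK, hEn, ⟨e⟩, hmul.symm, b, by rw [hmul, hn, hb]⟩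

/-- It is enough to find `K > H` with `[K : H]` finite: modulo the normal core of `H` in `K` one has
a finite `p`-group, where the normaliser condition holds. If `T ≤ H`, take `K = S`; otherwise
enlarge `H` by a finite torsion subgroup of `T` that is not contained in `H`. -/
theorem IsDiscretePToral.lt_normalizer [hp : Fact p.Prime] (hS : IsDiscretePToral p S)
    {H : Subgroup S} (hH : H ≠ ⊤) : H < Subgroup.normalizer (H : Set S) := by
  obtain ⟨T, hTn, hT, hT0, -, hSp⟩ := hS.exists_torus
  obtain ⟨K, hHK, hK0⟩ : ∃ K : Subgroup S, H < K ∧ H.relIndex K ≠ 0 := by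
    by_cases hTH : T ≤ H
    · refine ⟨⊤, lt_top_iff_ne_top.2 hH, ?_⟩
      rw [Subgroup.relIndex_top_right]
      exact fun h => hT0 (Nat.eq_zero_of_zero_dvd (h ▸ Subgroup.index_dvd_of_le hTH))
    · obtain ⟨t, htT, htH⟩ := SetLike.not_le_iff_exists.1 hTH
      obtain ⟨k, hk⟩ := hT.tors t htT
      let X : Subgroup S :=
        { carrier := {x | x ∈ T ∧ x ^ p ^ k = 1}
          one_mem' := ⟨T.one_mem, one_pow _⟩
          mul_mem' := fun {a b} ha hb => ⟨T.mul_mem ha.1 hb.1, by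
            rw [Commute.mul_pow (hT.comm a ha.1 b hb.1), ha.2, hb.2, one_mul]⟩
          inv_mem' := fun {a} ha => ⟨T.inv_mem ha.1, by rw [inv_pow, ha.2, inv_one]⟩ }
      have hXn : X.Normal := ⟨fun x hx g => ⟨hTn.conj_mem x hx.1 g, by
        rw [conj_pow, hx.2, mul_one, mul_inv_cancel]⟩⟩
      have hXf : Finite X := (hT.finite_torsion k).to_subtype
      refine ⟨H ⊔ X, lt_of_le_of_ne le_sup_left fun h => htH ?_, ?_⟩
      · rw [h]
        exact (le_sup_right : X ≤ H ⊔ X) ⟨htT, hk⟩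
      · have : Finite (↥(H ⊔ X) ⧸ H.subgroupOf (H ⊔ X)) := by
          refine Finite.of_surjective (α := X)
            (fun x => QuotientGroup.mk ⟨x, (le_sup_right : X ≤ H ⊔ X) x.2⟩) fun q => ?_
          obtain ⟨⟨y, hy⟩, rfl⟩ := QuotientGroup.mk_surjective q
          have hy' := hy
          rw [sup_comm, ← SetLike.mem_coe, Subgroup.normal_mul] at hy'
          obtain ⟨x, hx, h, hh, rfl⟩ := hy'
          refine ⟨⟨x, hx⟩, ?_⟩
          rw [QuotientGroup.eq, Subgroup.mem_subgroupOf]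
          simpa using hh
        exact Subgroup.index_ne_zero_of_finite
  have hlt : H.subgroupOf K ≠ ⊤ := fun h => not_le_of_gt hHK (Subgroup.subgroupOf_eq_top.1 h)
  have : (H.subgroupOf K).FiniteIndex := ⟨hK0⟩
  let C := (H.subgroupOf K).normalCore
  have hC : C ≤ H.subgroupOf K := Subgroup.normalCore_le _
  have hq : IsPGroup p (K ⧸ C) := (hSp.to_subgroup K).to_quotient _
  have := hq.isNilpotent
  have hsurj : Function.Surjective (QuotientGroup.mk' C) := QuotientGroup.mk'_surjective C
  have hcm : ((H.subgroupOf K).map (QuotientGroup.mk' C)).comap (QuotientGroup.mk' C) =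
      H.subgroupOf K := Subgroup.comap_map_eq_self (by rwa [QuotientGroup.ker_mk'])
  have hne : (H.subgroupOf K).map (QuotientGroup.mk' C) < ⊤ := by
    rw [lt_top_iff_ne_top]
    intro h
    rw [h, Subgroup.comap_top] at hcm
    exact hlt hcm.symm
  obtain ⟨x, hx, hxH⟩ := SetLike.exists_of_lt (Group.normalizerCondition_of_isNilpotent _ hne)
  obtain ⟨k, rfl⟩ := hsurj x
  have hkn : k ∈ Subgroup.normalizer (H.subgroupOf K : Set K) := by
    have h1 := Subgroup.comap_normalizer_eq_of_surjective
      ((H.subgroupOf K).map (QuotientGroup.mk' C)) hsurj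
    rw [hcm] at h1
    rw [← h1]
    exact hx
  refine lt_of_le_of_ne Subgroup.le_normalizer fun h => hxH ?_
  have hkH : (k : S) ∈ H := by
    rw [h, Subgroup.mem_normalizer_iff]
    intro y
    constructor
    · intro hy
      exact (Subgroup.mem_normalizer_iff.1 hkn ⟨y, hHK.le hy⟩).1 hy
    · intro hy
      have hyK : y ∈ K := by
        have := K.mul_mem (K.mul_mem (K.inv_mem k.2) (hHK.le hy)) k.2
        simpa [mul_assoc] using this
      exact (Subgroup.mem_normalizer_iff.1 hkn ⟨y, hyK⟩).2 hy
  exact ⟨k, hkH, rfl⟩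

/-! ### Bounds for the groups between an element centraliser and its normaliser -/

theorem relIndex_centralizer_normalizer_le {T : Subgroup S} [T.Normal]
    (hcomm : ∀ x ∈ T, ∀ y ∈ T, x * y = y * x) (hT0 : T.index ≠ 0)
    (hfin : {x : S | x ∈ T ∧ x ^ T.index = 1}.Finite) (y : S) {N : Subgroup S}
    (hN : N ≤ Subgroup.normalizer (Subgroup.centralizer {y} : Set S))
    (hCN : T ⊓ Subgroup.centralizer {y} ≤ N) :
    (T ⊓ Subgroup.centralizer {y}).relIndex N ≠ 0 ∧
      (T ⊓ Subgroup.centralizer {y}).relIndex N ≤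
        {x : S | x ∈ T ∧ x ^ T.index = 1}.ncard * T.index := by
  have hC : ∀ x, x ∈ Subgroup.centralizer {y} ↔ x * y = y * x := fun x => by
    rw [Subgroup.mem_centralizer_singleton_iff]
  -- Since `t` normalises `C_S(y)`, the commutator `[t, y]` commutes with `y`. With `n = [S : T]`,
  -- the power `y ^ n` lies in the abelian group `T`, so conjugation by `t` fixes it, and therefore
  -- `[t, y] ^ n = 1`.
  have hδ : ∀ t ∈ T ⊓ N, t * y * t⁻¹ * y⁻¹ ∈ {x : S | x ∈ T ∧ x ^ T.index = 1} := by
    rintro t ⟨htT, htN⟩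
    have h1 : t * y * t⁻¹ ∈ Subgroup.centralizer {y} :=
      (Subgroup.mem_normalizer_iff.1 (hN htN) y).1 ((hC y).2 rfl)
    have h2 : Commute (t * y * t⁻¹ * y⁻¹) y :=
      Commute.mul_left ((hC _).1 h1) (Commute.refl y).inv_left
    refine ⟨?_, ?_⟩
    · have := T.mul_mem htT (‹T.Normal›.conj_mem _ (T.inv_mem htT) y)
      simpa [mul_assoc] using this
    · have h3 : (t * y * t⁻¹ * y⁻¹ * y) ^ T.index = y ^ T.index := by
        rw [inv_mul_cancel_right, conj_pow, hcomm t htT _ (T.pow_index_mem y),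
          mul_inv_cancel_right]
      rw [h2.mul_pow] at h3
      simpa using h3
  have h1 : (T ⊓ Subgroup.centralizer {y}).relIndex (T ⊓ N) ≠ 0 ∧
      (T ⊓ Subgroup.centralizer {y}).relIndex (T ⊓ N) ≤
        {x : S | x ∈ T ∧ x ^ T.index = 1}.ncard := by
    have := hfin.to_subtype
    -- Elements of `T ∩ N` with the same commutator with `y` differ by an element of `C_T(y)`, so
    -- the cosets of `C_T(y)` inject into a finite torsion set.
    let f : (↥(T ⊓ N) ⧸ (T ⊓ Subgroup.centralizer {y}).subgroupOf (T ⊓ N)) →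
        {x : S | x ∈ T ∧ x ^ T.index = 1} := fun c => ⟨_, hδ c.out c.out.2⟩
    have hf : Function.Injective f := by
      intro c d hcd
      have h := congrArg Subtype.val hcd
      simp only [f, mul_left_inj] at h
      rw [← c.out_eq', ← d.out_eq']
      change QuotientGroup.mk _ = QuotientGroup.mk _
      rw [QuotientGroup.eq, Subgroup.mem_subgroupOf]
      refine ⟨T.mul_mem (T.inv_mem c.out.2.1) d.out.2.1, (hC _).2 ?_⟩
      change (c.out.1)⁻¹ * d.out.1 * y = y * ((c.out.1)⁻¹ * d.out.1)
      calc (c.out.1)⁻¹ * d.out.1 * y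
          = (c.out.1)⁻¹ * (d.out.1 * y * (d.out.1)⁻¹) * d.out.1 := by group
        _ = y * ((c.out.1)⁻¹ * d.out.1) := by
          rw [← h]
          group
    have hfi : Finite (↥(T ⊓ N) ⧸ (T ⊓ Subgroup.centralizer {y}).subgroupOf (T ⊓ N)) :=
      Finite.of_injective f hf
    exact ⟨Subgroup.index_ne_zero_of_finite, Nat.card_le_card_of_injective f hf⟩
  have hd := Subgroup.relIndex_dvd_index_of_normal T N
  have h2 : T.relIndex N ≠ 0 := fun h => hT0 (Nat.eq_zero_of_zero_dvd (h ▸ hd))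
  rw [← Subgroup.relIndex_mul_relIndex _ (T ⊓ N) N (le_inf inf_le_left hCN) inf_le_right,
    Subgroup.inf_relIndex_right]
  exact ⟨mul_ne_zero h1.1 h2,
    Nat.mul_le_mul h1.2 (Nat.le_of_dvd (Nat.pos_of_ne_zero hT0) hd)⟩

/-- The orders of the groups between a centraliser `C_S(y)` and its normaliser are bounded, because
`C_T(y)` depends only on the coset `yT`. -/
theorem IsDiscretePToral.exists_bound_toralOrder [hp : Fact p.Prime] (hS : IsDiscretePToral p S) :
    ∃ B : ℕ, ∀ (y : S) (N : Subgroup S), Subgroup.centralizer {y} ≤ N →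
      N ≤ Subgroup.normalizer (Subgroup.centralizer {y} : Set S) →
      ∀ r m, HasToralOrder p N r m → r ≤ B ∧ m ≤ B := by
  obtain ⟨T, hTn, hT, hT0, ⟨a, ha⟩, hSp⟩ := hS.exists_torus
  obtain ⟨R, M, hRM⟩ := hS.exists_hasToralOrder ⊤
  have : T.FiniteIndex := ⟨hT0⟩
  have : Fintype (S ⧸ T) := Fintype.ofFinite _
  choose ρ μ hμ using fun c : S ⧸ T =>
    hS.exists_hasToralOrder (T ⊓ Subgroup.centralizer {c.out})
  set b := {x : S | x ∈ T ∧ x ^ T.index = 1}.ncard * T.index with hb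
  -- The rank is at most the rank `R` of `S`. The second component of the order of `N` is that of
  -- `C_T(y)`, one of the finitely many `μ c`, times `[N : C_T(y)] ≤ b`.
  refine ⟨R + (∑ c, μ c) * b, fun y N hCN hN r m hm => ⟨?_, ?_⟩⟩
  · rcases toralOrder_le_of_le le_top hm hRM with h | h <;> omega
  have hcos : T ⊓ Subgroup.centralizer {y} =
      T ⊓ Subgroup.centralizer {(QuotientGroup.mk y : S ⧸ T).out} := by
    obtain ⟨t, ht⟩ := QuotientGroup.mk_out_eq_mul T y
    rw [ht]
    ext x
    simp only [Subgroup.mem_inf, Subgroup.mem_centralizer_singleton_iff]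
    refine and_congr_right fun hx => ?_
    have hxt : Commute x t := hT.comm x hx t t.2
    constructor
    · intro h
      exact Commute.mul_right h hxt
    · intro h
      have := Commute.mul_right (h : Commute x _) hxt.inv_right
      rwa [mul_inv_cancel_right] at this
  obtain ⟨h0, hle⟩ := relIndex_centralizer_normalizer_le hT.comm hT0
    (by rw [ha]; exact hT.finite_torsion a) y hN (inf_le_right.trans hCN)
  have hO := hμ (QuotientGroup.mk y)
  rw [← hcos] at hO
  have hO' := hS.hasToralOrder_of_relIndex_ne_zero (inf_le_right.trans hCN) h0 hO
  rw [(toralOrder_unique hm hO').2]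
  refine le_trans (Nat.mul_le_mul (Finset.single_le_sum (f := μ) (fun _ _ => Nat.zero_le _)
    (Finset.mem_univ _)) hle) (Nat.le_add_left _ _)

/-! ### Comparison of orders and maximal members of bounded families -/

theorem IsDiscretePToral.toralOrderLE_of_le [Fact p.Prime] (hS : IsDiscretePToral p S)
    {H K : Subgroup S} (h : H ≤ K) : ToralOrderLE p H K := by
  obtain ⟨r, m, hH⟩ := hS.exists_hasToralOrder H
  obtain ⟨s, n, hK⟩ := hS.exists_hasToralOrder K
  exact ⟨r, m, s, n, hH, hK, (toralOrder_le_of_le h hH hK).imp id fun h => ⟨h.1, h.2.1⟩⟩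

theorem eq_of_le_of_toralOrderLE [Fact p.Prime] {H K : Subgroup S} (h : H ≤ K)
    (hKH : ToralOrderLE p K H) : H = K := by
  obtain ⟨s, n, r, m, hK, hH, hle⟩ := hKH
  rcases toralOrder_le_of_le h hH hK with h1 | ⟨h1, h2, h3⟩
  · omega
  · exact h3 (by omega)

/-- Among the members of a family of subgroups of bounded order there is one of greatest order. -/
theorem IsDiscretePToral.exists_max_toralOrder [Fact p.Prime] (hS : IsDiscretePToral p S)
    {ι : Type*} [Nonempty ι] (H : ι → Subgroup S) (B : ℕ)
    (hB : ∀ i r m, HasToralOrder p (H i) r m → r ≤ B ∧ m ≤ B) :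
    ∃ i, ∀ j, ToralOrderLE p (H j) (H i) := by
  choose r m hrm using fun i => hS.exists_hasToralOrder (H i)
  -- As `m i ≤ B`, this number encodes the lexicographic order on the pairs `(r i, m i)`.
  let f : ι → ℕ := fun i => r i * (B + 1) + m i
  have hf : BddAbove (Set.range f) := by
    refine ⟨B * (B + 1) + B, ?_⟩
    rintro _ ⟨i, rfl⟩
    obtain ⟨h1, h2⟩ := hB i _ _ (hrm i)
    exact Nat.add_le_add (Nat.mul_le_mul_right _ h1) h2
  obtain ⟨i, hi⟩ := Nat.sSup_mem (Set.range_nonempty f) hf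
  refine ⟨i, fun j => ⟨_, _, _, _, hrm j, hrm i, ?_⟩⟩
  have hj : f j ≤ f i := by
    rw [hi]
    exact le_csSup hf ⟨j, rfl⟩
  have h1 := (hB i _ _ (hrm i)).2
  simp only [f] at hj
  rcases lt_trichotomy (r j) (r i) with h | h | h
  · exact Or.inl h
  · rw [h] at hj
    exact Or.inr ⟨h, by omega⟩
  · exfalso
    have h2 : (r i + 1) * (B + 1) ≤ r j * (B + 1) := Nat.mul_le_mul_right _ h
    rw [add_mul] at h2
    omega

theorem ToralOrderLE.congr {P P' Q Q' : Type*} [Group P] [Group P'] [Group Q] [Group Q']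
    (e : P ≃* P') (f : Q ≃* Q') (h : ToralOrderLE p P Q) : ToralOrderLE p P' Q' := by
  obtain ⟨r, m, s, n, h1, h2, h3⟩ := h
  exact ⟨r, m, s, n, h1.of_mulEquiv e, h2.of_mulEquiv f, h3⟩

theorem ToralOrderLE.trans [Fact p.Prime] {P R : Type*} [Group P] [Group R] {Q : Subgroup S}
    (h : ToralOrderLE p P Q) (h' : ToralOrderLE p Q R) : ToralOrderLE p P R := by
  obtain ⟨r, m, s, n, h1, h2, h3⟩ := h
  obtain ⟨r', m', s', n', h1', h2', h3'⟩ := h'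
  obtain ⟨rfl, rfl⟩ := toralOrder_unique h2 h1'
  exact ⟨r, m, s', n', h1, h2', by omega⟩

theorem IsPGroup.isDiscretePToral_of_finite [Fact p.Prime] {P : Type*} [Group P] [Finite P]
    (hP : IsPGroup p P) : IsDiscretePToral p P := by
  obtain ⟨a, ha⟩ := IsPGroup.iff_card.1 hP
  exact ⟨0, p ^ a, ⊥, inferInstance, ⟨MulEquiv.ofUnique⟩, by rw [Subgroup.index_bot, ha], a, rfl⟩

end Toral

/-! ### Morphisms of fusion systems -/

namespace FusionSystem

variable {S : Type u} [Group S] {F : FusionSystem S}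

theorem inclusion_mem {P Q : Subgroup S} (h : P ≤ Q) : Subgroup.inclusion h ∈ F.Hom P Q := by
  have h1 := F.conj_mem (1 : S) (Transports.of_le h)
  have e : conjHom (1 : S) (Transports.of_le h) = Subgroup.inclusion h := by
    ext x
    simp [conjHom]
  rwa [e] at h1

theorem IsIso.symm {P Q : Subgroup S} {e : P ≃* Q} (h : F.IsIso e) : F.IsIso e.symm :=
  ⟨h.2, h.1⟩

theorem IsIso.trans {P Q R : Subgroup S} {e : P ≃* Q} {f : Q ≃* R} (he : F.IsIso e)
    (hf : F.IsIso f) : F.IsIso (e.trans f) :=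
  ⟨F.comp_mem _ he.1 _ hf.1, F.comp_mem _ hf.2 _ he.2⟩

theorem IsConj.refl (P : Subgroup S) : F.IsConj P P :=
  ⟨MulEquiv.refl P, F.id_mem P, F.id_mem P⟩

theorem IsConj.symm {P Q : Subgroup S} (h : F.IsConj P Q) : F.IsConj Q P := by
  obtain ⟨e, he⟩ := h
  exact ⟨e.symm, he.symm⟩

theorem IsConj.trans {P Q R : Subgroup S} (h : F.IsConj P Q) (h' : F.IsConj Q R) :
    F.IsConj P R := by
  obtain ⟨e, he⟩ := h
  obtain ⟨f, hf⟩ := h'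
  exact ⟨e.trans f, he.trans hf⟩

theorem exists_isIso {P Q : Subgroup S} {f : P →* Q} (hf : f ∈ F.Hom P Q) :
    ∃ (R : Subgroup S) (e : P ≃* R), R ≤ Q ∧ F.IsIso e ∧ ∀ x : P, (e x : S) = f x := by
  obtain ⟨R, hR, e, he, he', rfl⟩ := F.factor f hf
  exact ⟨R, e, hR, ⟨he, he'⟩, fun x => rfl⟩

theorem IsIso.comp_inclusion_mem {P Q R : Subgroup S} {e : P ≃* Q} (he : F.IsIso e) (h : Q ≤ R) :
    (Subgroup.inclusion h).comp e.toMonoidHom ∈ F.Hom P R :=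
  F.comp_mem _ he.1 _ (inclusion_mem h)

theorem IsIso.exists_restrict {P Q A : Subgroup S} {e : P ≃* Q} (he : F.IsIso e) (h : A ≤ P) :
    ∃ (B : Subgroup S) (f : A ≃* B), B ≤ Q ∧ F.IsIso f ∧
      ∀ x : A, (f x : S) = e ⟨x, h x.2⟩ :=
  exists_isIso (F.comp_mem _ (inclusion_mem h) _ he.1)

theorem IsCentric.of_isConj {P Q : Subgroup S} (hP : F.IsCentric P) (h : F.IsConj P Q) :
    F.IsCentric Q := fun R hR => hP R (h.trans hR)

theorem IsCentric.mem_of_mem_centralizer {P : Subgroup S} (hP : F.IsCentric P) {x : S}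
    (hx : x ∈ Subgroup.centralizer (P : Set S)) : x ∈ P := by
  rw [hP P (IsConj.refl P)] at hx
  obtain ⟨y, -, rfl⟩ := hx
  exact y.2

/-- A conjugate of `Q` contains a conjugate of `P`, which already contains its own centraliser in
`S`. -/
theorem IsCentric.of_le {P Q : Subgroup S} (hP : F.IsCentric P) (h : P ≤ Q) :
    F.IsCentric Q := by
  rintro Q' ⟨e, he⟩
  obtain ⟨P', f, hP'Q', hf, -⟩ := he.exists_restrict h
  apply le_antisymm
  · intro x hx
    have hxP : x ∈ P' := (hP.of_isConj ⟨f, hf⟩).mem_of_mem_centralizer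
      (Subgroup.centralizer_le hP'Q' hx)
    refine ⟨⟨x, hP'Q' hxP⟩, ?_, rfl⟩
    rw [SetLike.mem_coe, Subgroup.mem_center_iff]
    exact fun g => Subtype.ext (Subgroup.mem_centralizer_iff.1 hx g g.2)
  · rintro _ ⟨x, hx, rfl⟩
    rw [Subgroup.mem_centralizer_iff]
    exact fun g hg => congrArg Subtype.val (Subgroup.mem_center_iff.1 hx ⟨g, hg⟩)

/-! ### Extension of morphisms -/

theorem mem_autS_iff {P : Subgroup S} {a : MulAut P} :
    a ∈ autS P ↔ ∃ s ∈ Subgroup.normalizer (P : Set S), ∀ x : P, (a x : S) = s * x * s⁻¹ := by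
  constructor
  · rintro ⟨s, rfl⟩
    exact ⟨s, s.2, fun x => rfl⟩
  · rintro ⟨s, hs, h⟩
    exact ⟨⟨s, hs⟩, MulEquiv.ext fun x => Subtype.ext (h x).symm⟩

theorem innAut_le_autS (P : Subgroup S) : innAut P ≤ autS P := by
  rintro _ ⟨x, rfl⟩
  exact mem_autS_iff.2 ⟨x, Subgroup.le_normalizer x.2, fun y => by simp⟩

theorem autS_le_aut (P : Subgroup S) : autS P ≤ F.aut P := by
  rintro _ ⟨s, rfl⟩
  constructor
  · exact F.conj_mem s.1 (Transports.of_mem_normalizer s.2)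
  · change MulEquiv.toMonoidHom (P.normalizerMonoidHom s)⁻¹ ∈ F.Hom P P
    rw [← map_inv]
    exact F.conj_mem (s⁻¹).1 (Transports.of_mem_normalizer (s⁻¹).2)

theorem mem_extender_iff {P Q : Subgroup S} {f : P ≃* Q} {s : S} :
    s ∈ extender f ↔ ∃ hs : s ∈ Subgroup.normalizer (P : Set S),
      MulAut.congr f (P.normalizerMonoidHom ⟨s, hs⟩) ∈ autS Q := by
  constructor
  · rintro ⟨⟨s, hs⟩, h, rfl⟩
    exact ⟨hs, h⟩
  · rintro ⟨hs, h⟩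
    exact ⟨⟨s, hs⟩, h, rfl⟩

theorem le_extender {P Q : Subgroup S} (f : P ≃* Q) : P ≤ extender f := by
  intro x hx
  refine mem_extender_iff.2 ⟨Subgroup.le_normalizer hx, innAut_le_autS Q ⟨f ⟨x, hx⟩, ?_⟩⟩
  ext y
  have h : P.normalizerMonoidHom ⟨x, Subgroup.le_normalizer hx⟩ (f.symm y) =
      ⟨x, hx⟩ * f.symm y * ⟨x, hx⟩⁻¹ := rfl
  simp [MulAut.congr, h]

/-- Elements of `C_S(P)` induce the identity on `P`, and `f` conjugates this to the identity of `Q`.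
-/
theorem centralizer_le_extender {P Q : Subgroup S} (f : P ≃* Q) :
    Subgroup.centralizer (P : Set S) ≤ extender f := by
  intro s hs
  have hc : ∀ x ∈ P, s * x * s⁻¹ = x := fun x hx => by
    rw [← Subgroup.mem_centralizer_iff.1 hs x hx, mul_inv_cancel_right]
  have hsn : s ∈ Subgroup.normalizer (P : Set S) := Subgroup.centralizer_le_normalizer _ hs
  refine mem_extender_iff.2 ⟨hsn, ?_⟩
  have h1 : P.normalizerMonoidHom ⟨s, hsn⟩ = 1 := by
    ext x
    exact hc x x.2
  rw [h1, map_one]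
  exact Subgroup.one_mem _

/-! ### Fixed elements and the extension axiom -/

/-- `z` is fixed by all morphisms of `F` defined on `P`. -/
def Fixes (F : FusionSystem S) (z : S) (P : Subgroup S) : Prop :=
  ∀ f ∈ F.Hom P ⊤, ∀ hz : z ∈ P, (f ⟨z, hz⟩ : S) = z

theorem Fixes.apply_isIso {z : S} {P Q : Subgroup S} (h : F.Fixes z P) {e : P ≃* Q}
    (he : F.IsIso e) (hz : z ∈ P) : (e ⟨z, hz⟩ : S) = z :=
  h _ (he.comp_inclusion_mem le_top) hz

theorem fixes_of_isIso {z : S} {P : Subgroup S}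
    (h : ∀ (Q : Subgroup S) (e : P ≃* Q), F.IsIso e → ∀ hz : z ∈ P, (e ⟨z, hz⟩ : S) = z) :
    F.Fixes z P := by
  intro f hf hz
  obtain ⟨R, e, -, he, hef⟩ := exists_isIso hf
  rw [← hef]
  exact h R e he hz

theorem Fixes.of_isConj {z : S} {P Q : Subgroup S} (h : F.Fixes z P) (hPQ : F.IsConj P Q)
    (hz : z ∈ P) : F.Fixes z Q := by
  obtain ⟨e, he⟩ := hPQ
  intro f hf hzQ
  have h1 := h _ (F.comp_mem _ he.1 _ hf) hz
  have h2 : e ⟨z, hz⟩ = ⟨z, hzQ⟩ := Subtype.ext (h.apply_isIso he hz)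
  rw [← h2]
  exact h1

theorem IsSaturated.apply_eq_of_fixes_extender {p : ℕ} (hF : F.IsSaturated p) {P Q : Subgroup S}
    {f : P ≃* Q} (hf : F.IsIso f) (hQ : F.FullyCentralised p Q) {z : S} (hz : z ∈ P)
    (h : F.Fixes z (extender f)) : (f ⟨z, hz⟩ : S) = z := by
  obtain ⟨g, hg, hgf⟩ := hF.extension P Q f hf hQ
  rw [← hgf z hz (le_extender f hz)]
  exact h g hg _

/-- A central element `z` of `S` generates a fully centralised subgroup, so that a morphism
carrying `x` to `z` extends to the centraliser of `x`. -/
theorem IsSaturated.exists_extension_centralizer {p : ℕ} [Fact p.Prime] (hS : IsDiscretePToral p S)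
    (hF : F.IsSaturated p) {z : S} (hz : ∀ g : S, g * z = z * g) {P Q : Subgroup S} {e : P ≃* Q}
    (he : F.IsIso e) (hzP : z ∈ P) :
    ∃ g ∈ F.Hom (Subgroup.centralizer {(e ⟨z, hzP⟩ : S)}) ⊤,
      ∀ h, (g ⟨e ⟨z, hzP⟩, h⟩ : S) = z := by
  set x : Q := e ⟨z, hzP⟩ with hx
  obtain ⟨A, f, -, hf, hfx⟩ := he.symm.exists_restrict
    (A := Subgroup.zpowers (x : S)) (by simp)
  have hfx' : ∀ n : ℤ, (f ⟨(x : S) ^ n, n, rfl⟩ : S) = z ^ n := by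
    intro n
    rw [hfx]
    have : (⟨(x : S) ^ n, Subgroup.zpow_mem _ x.2 n⟩ : Q) = x ^ n := rfl
    rw [this, map_zpow, hx, e.symm_apply_apply, Subgroup.coe_zpow]
  have hA : ∀ a ∈ A, ∀ g : S, g * a = a * g := by
    intro a ha g
    obtain ⟨⟨_, n, rfl⟩, hn⟩ := f.surjective ⟨a, ha⟩
    have h1 := congrArg Subtype.val hn
    simp only at h1
    rw [← h1, hfx' n]
    exact Commute.zpow_right (hz g) n
  have hAtop : Subgroup.centralizer (A : Set S) = ⊤ := by
    rw [eq_top_iff]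
    exact fun g _ => Subgroup.mem_centralizer_iff.2 fun a ha => (hA a ha g).symm
  -- The group `A` consists of powers of `z`, so `C_S(A) = S`, and no centraliser has greater order.
  have hfc : F.FullyCentralised p A := fun P' _ => hS.toralOrderLE_of_le (by simp [hAtop])
  obtain ⟨g, hg, hgf⟩ := hF.extension _ A f hf hfc
  have hle : Subgroup.centralizer {(x : S)} ≤ extender f := by
    refine le_trans ?_ (centralizer_le_extender f)
    rw [← Subgroup.centralizer_closure, ← Subgroup.zpowers_eq_closure]
  refine ⟨_, F.comp_mem _ (inclusion_mem hle) _ hg, fun h => ?_⟩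
  have h1 := hgf (x : S) (Subgroup.mem_zpowers _) (hle h)
  have h2 := hfx' 1
  simp only [zpow_one] at h2
  exact h1.trans h2

theorem mem_autS_of_mk_mem_outS {P : Subgroup S} {a : F.aut P}
    (h : (QuotientGroup.mk a : F.Out P) ∈ F.outS P) : (a : MulAut P) ∈ autS P := by
  obtain ⟨b, hb, hba⟩ := h
  have h1 : (b⁻¹ * a : F.aut P) ∈ (innAut P).subgroupOf (F.aut P) := QuotientGroup.eq.1 hba
  have h2 := (autS P).mul_mem (Subgroup.mem_subgroupOf.1 hb)
    (innAut_le_autS P (Subgroup.mem_subgroupOf.1 h1))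
  simpa using h2

theorem IsIso.congr_mem {P Q : Subgroup S} {f : P ≃* Q} (hf : F.IsIso f) {a : MulAut P}
    (ha : a ∈ F.aut P) : MulAut.congr f a ∈ F.aut Q :=
  hf.symm.trans (IsIso.trans ha hf)

/-- A morphism onto a fully normalised subgroup `Q` can be changed by an automorphism of `Q` so
that it extends to the normaliser of its source. -/
theorem IsSaturated.exists_aut_normalizer_le_extender {p : ℕ} [Fact p.Prime] (hS : IsPGroup p S)
    (hF : F.IsSaturated p) {P Q : Subgroup S} {f : P ≃* Q} (hf : F.IsIso f)
    (hQ : F.FullyNormalised p Q) :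
    ∃ χ : Q ≃* Q, F.IsIso χ ∧ Subgroup.normalizer (P : Set S) ≤ extender (f.trans χ) := by
  obtain ⟨-, hfin, -, hsyl⟩ := hF.sylow Q hQ
  let Φ : Subgroup.normalizer (P : Set S) →* F.aut Q :=
    ((MulAut.congr f).toMonoidHom.comp P.normalizerMonoidHom).codRestrict (F.aut Q)
      fun s => hf.congr_mem (autS_le_aut P ⟨s, rfl⟩)
  let Ψ : Subgroup.normalizer (P : Set S) →* F.Out Q := (QuotientGroup.mk' _).comp Φ
  -- The image of `N_S(P)` in the finite group `Out_F(Q)` is a `p`-group, so Sylow's condition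
  -- conjugates it into `Out_S(Q)`. A representative of the conjugating element is the required `χ`.
  have hK : IsPGroup p Ψ.range :=
    (hS.to_subgroup _).of_surjective Ψ.rangeRestrict Ψ.rangeRestrict_surjective
  obtain ⟨g, hg⟩ := hsyl Ψ.range hK.isDiscretePToral_of_finite
  obtain ⟨χ, rfl⟩ := QuotientGroup.mk_surjective g
  refine ⟨χ.1, χ.2, fun s hs => mem_extender_iff.2 ⟨hs, ?_⟩⟩
  exact mem_autS_of_mk_mem_outS (a := χ * Φ ⟨s, hs⟩ * χ⁻¹) (hg _ ⟨⟨s, hs⟩, rfl⟩)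

/-- If `Q` is fully normalised and not radical, then every automorphism of `Q` in `F` extends to
a strictly larger subgroup. -/
theorem IsSaturated.lt_extender_of_not_isRadical {p : ℕ} [Fact p.Prime] (hF : F.IsSaturated p)
    {Q : Subgroup S} (hQ : F.FullyNormalised p Q) (hr : ¬ F.IsRadical p Q) {χ : Q ≃* Q}
    (hχ : F.IsIso χ) : Q < extender χ := by
  obtain ⟨-, hfin, -, hsyl⟩ := hF.sylow Q hQ
  rw [IsRadical] at hr
  push Not at hr
  obtain ⟨K, hKn, hKp, hK⟩ := hr
  obtain ⟨g, hg⟩ := hsyl K hKp.isDiscretePToral_of_finite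
  -- A normal `p`-subgroup lies in every Sylow subgroup.
  have hKS : K ≤ F.outS Q := fun k hk => by
    have h1 := hg _ (hKn.conj_mem k hk g⁻¹)
    simpa [mul_assoc] using h1
  obtain ⟨k, hk, hk1⟩ := K.bot_or_exists_ne_one.resolve_left hK
  obtain ⟨a, ha, rfl⟩ := hKS hk
  obtain ⟨s, hs⟩ := Subgroup.mem_subgroupOf.1 ha
  refine lt_of_le_of_ne (le_extender χ) fun h => hk1 ?_
  -- The automorphism `c_s` represents an element of `K`. So does its conjugate by `χ`, by
  -- normality, and this is therefore induced by `S`; thus `s` lies in the extender, assumed equal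
  -- to `Q`. But then `c_s` is inner and `k` is trivial.
  have hsQ : (s : S) ∈ Q := by
    refine h.symm.le (mem_extender_iff.2 ⟨s.2, ?_⟩)
    let χ' : F.aut Q := ⟨χ, hχ⟩
    have h1 : (QuotientGroup.mk (χ' * a * χ'⁻¹) : F.Out Q) ∈ K :=
      hKn.conj_mem _ hk (QuotientGroup.mk χ')
    have h2 := mem_autS_of_mk_mem_outS (hKS h1)
    have h3 : MulAut.congr χ (Q.normalizerMonoidHom s) =
        ((χ' * a * χ'⁻¹ : F.aut Q) : MulAut Q) := by
      rw [hs]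
      rfl
    exact h3 ▸ h2
  rw [QuotientGroup.mk'_apply, QuotientGroup.eq_one_iff, Subgroup.mem_subgroupOf]
  refine ⟨⟨s, hsQ⟩, ?_⟩
  rw [← hs]
  exact MulEquiv.ext fun y => rfl

end FusionSystem

/-! ### Alperin's argument for a central fixed element -/

namespace FusionSystem

variable {p : ℕ} {S : Type u} [Group S] {F : FusionSystem S}

theorem IsCentric.mem_of_central {P : Subgroup S} (hP : F.IsCentric P) {z : S}
    (hz : ∀ g : S, g * z = z * g) : z ∈ P :=
  hP.mem_of_mem_centralizer (Subgroup.mem_centralizer_iff.2 fun g _ => hz g)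

/-- A subgroup of `S` isomorphic to `S` has the same order and is therefore `S` itself, so every
morphism on `S` is essentially an automorphism. -/
theorem fixes_top [Fact p.Prime] (hS : IsDiscretePToral p S) {z : S}
    (h : ∀ e ∈ F.aut ⊤, (e ⟨z, Subgroup.mem_top z⟩ : S) = z) : F.Fixes z ⊤ := by
  refine fixes_of_isIso fun Q e he hz => ?_
  obtain rfl : Q = ⊤ := eq_of_le_of_toralOrderLE (p := p) le_top
    ((hS.toralOrderLE_of_le (le_refl (⊤ : Subgroup S))).congr (MulEquiv.refl _) e)
  exact h e he

/-- Among the conjugates of a subgroup all of whose conjugates are centralisers of elements,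
there is a fully normalised one. -/
theorem exists_fullyNormalised_of_centralizer [Fact p.Prime] (hS : IsDiscretePToral p S)
    {P : Subgroup S} (h : ∀ Q, F.IsConj P Q → ∃ y : S, Q = Subgroup.centralizer {y}) :
    ∃ Q, F.IsConj P Q ∧ F.FullyNormalised p Q := by
  obtain ⟨B, hB⟩ := hS.exists_bound_toralOrder
  have : Nonempty {Q : Subgroup S // F.IsConj P Q} := ⟨⟨P, IsConj.refl P⟩⟩
  obtain ⟨Q, hQ⟩ := hS.exists_max_toralOrder
    (fun Q : {Q : Subgroup S // F.IsConj P Q} => Subgroup.normalizer (Q.1 : Set S)) B (by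
      rintro ⟨Q, hQ⟩ r m hm
      obtain ⟨y, rfl⟩ := h Q hQ
      exact hB y _ Subgroup.le_normalizer le_rfl r m hm)
  exact ⟨Q.1, Q.2, fun P' hP' => hQ ⟨P', Q.2.trans hP'⟩⟩

/-- A conjugacy class of centric subgroups whose proper overgroups fix `z` also fixes `z`, if it
contains a fully normalised member all of whose automorphisms fix `z`. -/
theorem IsSaturated.fixes_of_fullyNormalised [Fact p.Prime] (hS : IsDiscretePToral p S)
    (hF : F.IsSaturated p) {z : S} {P : Subgroup S} (hP : F.FullyNormalised p P)
    (hz : ∀ Q, F.IsConj P Q → z ∈ Q) (htop : ¬ F.IsConj P ⊤)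
    (hover : ∀ Q R, F.IsConj P Q → Q < R → F.Fixes z R)
    (haut : ∀ e : P ≃* P, F.IsIso e → ∀ hzP : z ∈ P, (e ⟨z, hzP⟩ : S) = z) :
    F.Fixes z P := by
  obtain ⟨-, -, -, -, -, hSp⟩ := hS.exists_torus
  have key : ∀ (Q : Subgroup S) (f : Q ≃* P), F.IsIso f → ∀ hzQ : z ∈ Q,
      (f ⟨z, hzQ⟩ : S) = z := by
    intro Q f hf hzQ
    have hPQ : F.IsConj P Q := ⟨f.symm, hf.symm⟩
    obtain ⟨χ, hχ, hle⟩ := hF.exists_aut_normalizer_le_extender hSp hf hP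
    have hQt : Q ≠ ⊤ := by
      rintro rfl
      exact htop hPQ
    -- The modified map `χ ∘ f` extends to a group containing `N_S(Q) > Q`, where `z` is fixed.
    -- Undoing `χ` costs nothing, because automorphisms of `P` fix `z`.
    have h1 := hF.apply_eq_of_fixes_extender (hf.trans hχ) (hF.sylow P hP).1 hzQ
      (hover Q _ hPQ ((hS.lt_normalizer hQt).trans_le hle))
    have h2 := haut χ.symm hχ.symm (hz P (IsConj.refl P))
    have h3 : (f.trans χ) ⟨z, hzQ⟩ = ⟨z, hz P (IsConj.refl P)⟩ := Subtype.ext h1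
    rw [← h3] at h2
    simpa using h2
  refine fixes_of_isIso fun Q e he hzP => ?_
  have hzQ := hz Q ⟨e, he⟩
  have h1 : e.symm ⟨z, hzQ⟩ = ⟨z, hzP⟩ := Subtype.ext (key Q e.symm he.symm hzQ)
  rw [← h1, e.apply_symm_apply]

/-- An element of the centre of `S` that is fixed by the automorphism groups of the members of a
fusion controlling family is fixed by all morphisms between centric subgroups. -/
theorem IsSaturated.fixes_of_isFusionControlling [Fact p.Prime] (hS : IsDiscretePToral p S)
    (hF : F.IsSaturated p) {fam : Set (Subgroup S)} (hfam : F.IsFusionControlling p fam) {z : S}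
    (hz : ∀ g : S, g * z = z * g)
    (hfix : ∀ P ∈ fam, ∀ e ∈ F.aut P, ∀ hzP : z ∈ P, (e ⟨z, hzP⟩ : S) = z)
    {P : Subgroup S} (hP : F.IsCentric P) : F.Fixes z P := by
  -- the images of `z` other than `z` itself
  let X : Set S := {x | x ≠ z ∧ ∃ (Q R : Subgroup S) (e : Q ≃* R) (hzQ : z ∈ Q),
    F.IsCentric Q ∧ F.IsIso e ∧ (e ⟨z, hzQ⟩ : S) = x}
  have hXle : ∀ {Q R : Subgroup S} (e : Q ≃* R) (hzQ : z ∈ Q),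
      R ≤ Subgroup.centralizer {(e ⟨z, hzQ⟩ : S)} := by
    intro Q R e hzQ y hy
    rw [Subgroup.mem_centralizer_singleton_iff]
    have h1 : (⟨y, hy⟩ : R) * e ⟨z, hzQ⟩ = e ⟨z, hzQ⟩ * ⟨y, hy⟩ := by
      apply e.symm.injective
      rw [map_mul, map_mul, e.symm_apply_apply]
      exact Subtype.ext (hz _)
    exact congrArg Subtype.val h1
  -- The centraliser of `x` contains the image `R` of the morphism that carries `z` to `x`, so it is
  -- centric. The inverse map on the cyclic group generated by `x` extends to it.
  have hXmem : ∀ x ∈ X, F.IsCentric (Subgroup.centralizer {x}) ∧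
      ∃ (R : Subgroup S) (g : Subgroup.centralizer {x} ≃* R), F.IsIso g ∧
        ∀ h, (g ⟨x, h⟩ : S) = z := by
    rintro _ ⟨-, Q, R, e, hzQ, hQ, he, rfl⟩
    obtain ⟨g, hg, hgx⟩ := hF.exists_extension_centralizer hS hz he hzQ
    obtain ⟨R', g', -, hg', hgg'⟩ := exists_isIso hg
    refine ⟨(hQ.of_isConj ⟨e, he⟩).of_le (hXle e hzQ), R', g', hg', fun h => ?_⟩
    rw [hgg', hgx]
  by_contra hbad
  have hXne : Nonempty X := by
    by_contra hX
    refine hbad (fixes_of_isIso fun Q e he hzP => ?_)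
    by_contra hne
    exact hX ⟨⟨_, hne, P, Q, e, hzP, hP, he, rfl⟩⟩
  obtain ⟨B, hB⟩ := hS.exists_bound_toralOrder
  obtain ⟨⟨x, hxX⟩, hmax⟩ := hS.exists_max_toralOrder
    (fun x : X => Subgroup.centralizer {(x : S)}) B
    (fun x => hB x _ le_rfl Subgroup.le_normalizer)
  have hxC : x ∈ Subgroup.centralizer {x} := Subgroup.mem_centralizer_singleton_iff.2 rfl
  have hCx := hXmem x hxX
  simp only at hmax
  generalize Subgroup.centralizer {x} = C at hCx hmax hxC
  obtain ⟨hCc, R, g, hg, hgx⟩ := hCx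
  have hzQ : ∀ Q, F.IsConj C Q → z ∈ Q := fun Q hQ => (hCc.of_isConj hQ).mem_of_central hz
  have hzC : z ∈ C := hzQ C (IsConj.refl C)
  -- If `z` were fixed on `C`, the injective map `g` would send both `z` and `x` to `z`.
  have hCbad : ¬ F.Fixes z C := by
    intro h
    have h1 : g ⟨z, hzC⟩ = g ⟨x, hxC⟩ :=
      Subtype.ext ((h.apply_isIso hg hzC).trans (hgx hxC).symm)
    exact hxX.1 (congrArg Subtype.val (g.injective h1)).symm
  have hconjbad : ∀ Q, F.IsConj C Q → ¬ F.Fixes z Q := fun Q hQ h =>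
    hCbad (h.of_isConj hQ.symm (hzQ Q hQ))
  -- Maximality in usable form: `|R| = |R'| ≤ |C_S(y)| ≤ |C| = |Q|`, so the inclusion of `Q` in `R`
  -- is an equality.
  have heq : ∀ Q R : Subgroup S, F.IsConj C Q → Q ≤ R → ∀ {R' : Subgroup S} (e : R ≃* R')
      (y : S), y ∈ X → R' ≤ Subgroup.centralizer {y} → Q = R := by
    rintro Q R ⟨f, hf⟩ hQR R' e y hy hR'
    have h1 : ToralOrderLE p R' Q :=
      ((hS.toralOrderLE_of_le hR').trans (hmax ⟨y, hy⟩)).congr (MulEquiv.refl _) f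
    exact eq_of_le_of_toralOrderLE hQR (h1.congr e.symm (MulEquiv.refl _))
  have hover : ∀ Q R, F.IsConj C Q → Q < R → F.Fixes z R := by
    intro Q R hQ hQR
    refine fixes_of_isIso fun R' e he hzR => ?_
    by_contra hne
    exact hQR.ne (heq Q R hQ hQR.le e _
      ⟨hne, R, R', e, hzR, (hCc.of_isConj hQ).of_le hQR.le, he, rfl⟩ (hXle e hzR))
  -- If `e` moves `z`, then `Q` is the centraliser of `e(z)`. If `e` fixes `z`, use `e(x)` instead:
  -- it is the image of `z` under `e ∘ g⁻¹` and differs from `z = e(z)`.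
  have hcent : ∀ Q, F.IsConj C Q → ∃ y : S, Q = Subgroup.centralizer {y} := by
    rintro Q ⟨e, he⟩
    by_cases h : (e ⟨z, hzC⟩ : S) = z
    · have h1 : (g.symm.trans e) ⟨z, hzQ R ⟨g, hg⟩⟩ = e ⟨x, hxC⟩ := by
        have : g ⟨x, hxC⟩ = ⟨z, hzQ R ⟨g, hg⟩⟩ := Subtype.ext (hgx hxC)
        rw [← this]
        simp
      have hle := hXle (g.symm.trans e) (hzQ R ⟨g, hg⟩)
      refine ⟨_, heq Q _ ⟨e, he⟩ hle (MulEquiv.refl _) _ ⟨?_, R, Q, g.symm.trans e,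
        hzQ R ⟨g, hg⟩, hCc.of_isConj ⟨g, hg⟩, hg.symm.trans he, rfl⟩ le_rfl⟩
      intro h2
      rw [h1, ← h] at h2
      exact hxX.1 (congrArg Subtype.val (e.injective (Subtype.ext h2)))
    · exact ⟨_, heq Q _ ⟨e, he⟩ (hXle e hzC) (MulEquiv.refl _) _
        ⟨h, C, Q, e, hzC, hCc, he, rfl⟩ le_rfl⟩
  have htopfix : F.Fixes z ⊤ :=
    fixes_top hS fun e he => hfix ⊤ hfam.top_mem e he _
  have htop : ∀ Q, F.IsConj C Q → ¬ F.IsConj Q ⊤ := fun Q hQ h =>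
    hconjbad ⊤ (hQ.trans h) htopfix
  obtain ⟨Q, hCQ, hQ⟩ := exists_fullyNormalised_of_centralizer hS hcent
  -- In the radical case the conjugate in the family has automorphisms fixing `z` by hypothesis. In
  -- the other case each automorphism extends to a proper overgroup, where `z` is fixed.
  by_cases hr : F.IsRadical p Q
  · obtain ⟨Q', hQ'fam, hQQ'⟩ := hfam.exists_conj Q (hCc.of_isConj hCQ) hr
    have hCQ' := hCQ.trans hQQ'
    exact hconjbad Q' hCQ' (hF.fixes_of_fullyNormalised hS (hfam.fullyNormalised Q' hQ'fam)
      (fun R hR => hzQ R (hCQ'.trans hR)) (htop Q' hCQ')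
      (fun R R' hR => hover R R' (hCQ'.trans hR)) fun e he => hfix Q' hQ'fam e he)
  · exact hconjbad Q hCQ (hF.fixes_of_fullyNormalised hS hQ
      (fun R hR => hzQ R (hCQ.trans hR)) (htop Q hCQ)
      (fun R R' hR => hover R R' (hCQ.trans hR)) fun e he hzP =>
        hF.apply_eq_of_fixes_extender he (hF.sylow Q hQ).1 hzP
          (hover Q _ hCQ (hF.lt_extender_of_not_isRadical hQ hr he)))

end FusionSystem

/-! ### Central elements of amalgamated products -/

namespace Monoid.PushoutI

variable {ι : Type*} {G : ι → Type*} {H : Type*} [∀ i, Group (G i)] [Group H]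
  {φ : ∀ i, H →* G i}

variable (φ) in
/-- The product in the amalgam of a list of letters. -/
def letterProd (l : List (Σ i, G i)) : PushoutI φ := (l.map fun x => of x.1 x.2).prod

variable (φ) in
/-- Consecutive letters belong to different factors and no letter belongs to the base group. -/
def IsReducedList (l : List (Σ i, G i)) : Prop :=
  l.IsChain (fun x y => x.1 ≠ y.1) ∧ ∀ x ∈ l, x.2 ∉ (φ x.1).range

theorem letterProd_cons (x : Σ i, G i) (l : List (Σ i, G i)) :
    letterProd φ (x :: l) = of x.1 x.2 * letterProd φ l := by
  simp [letterProd]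

theorem letterProd_append (l l' : List (Σ i, G i)) :
    letterProd φ (l ++ l') = letterProd φ l * letterProd φ l' := by
  simp [letterProd]

/-- This is the normal form theorem: a reduced word whose product lies in the base group is empty.
-/
theorem IsReducedList.letterProd_ne_one (hφ : ∀ i, Function.Injective (φ i))
    {l : List (Σ i, G i)} (hl : IsReducedList φ l) (hne : l ≠ []) : letterProd φ l ≠ 1 := by
  intro h
  let w : CoprodI.Word G := ⟨l, fun x hx h1 => hl.2 x hx (h1 ▸ Subgroup.one_mem _), hl.1⟩
  have hw : Reduced φ w := hl.2
  have h2 : ofCoprodI (φ := φ) w.prod = letterProd φ l := by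
    simp only [CoprodI.Word.prod, letterProd, map_list_prod, List.map_map, w]
    rfl
  have := hw.eq_empty_of_mem_range hφ (by rw [h2, h]; exact Subgroup.one_mem _)
  exact hne (congrArg CoprodI.Word.toList this)

theorem exists_isReducedList (hφ : ∀ i, Function.Injective (φ i)) (g : PushoutI φ) :
    ∃ (b : H) (l : List (Σ i, G i)), IsReducedList φ l ∧ g = base φ b * letterProd φ l := by
  classical
  obtain ⟨d⟩ := NormalWord.transversal_nonempty φ hφ
  let w : NormalWord d := NormalWord.equiv g
  refine ⟨w.head, w.toList, ⟨w.chain_ne, ?_⟩, ?_⟩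
  · rintro ⟨i, x⟩ hx hr
    -- A letter of a normal word is a transversal representative. If it also lay in the base group,
    -- uniqueness of the factorisation would make it trivial.
    have h1 := w.normalized i x hx
    have h2 := (d.compl i).1 (a₁ := (⟨x, hr⟩, ⟨1, d.one_mem i⟩))
      (a₂ := (⟨1, Subgroup.one_mem _⟩, ⟨x, h1⟩)) (by simp)
    exact w.ne_one _ hx (congrArg (fun t => (t.1 : G i)) h2)
  · have h1 : w.prod = g := (NormalWord.equiv (d := d)).symm_apply_apply g
    rw [← h1, NormalWord.prod]
    congr 1
    simp only [CoprodI.Word.prod, letterProd, map_list_prod, List.map_map]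
    rfl

/-- The formal inverse of a list of letters. -/
def invLetters (l : List (Σ i, G i)) : List (Σ i, G i) :=
  (l.map fun x => ⟨x.1, x.2⁻¹⟩).reverse

theorem letterProd_invLetters (l : List (Σ i, G i)) :
    letterProd φ (invLetters l) = (letterProd φ l)⁻¹ := by
  simp only [letterProd, invLetters, List.map_reverse, List.map_map, List.prod_inv_reverse]
  congr 3

theorem IsReducedList.invLetters {l : List (Σ i, G i)} (hl : IsReducedList φ l) :
    IsReducedList φ (invLetters l) := by
  refine ⟨?_, ?_⟩
  · rw [PushoutI.invLetters, List.isChain_reverse, List.isChain_map]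
    exact hl.1.imp fun _ _ h => h.symm
  · intro x hx
    simp only [PushoutI.invLetters, List.mem_reverse, List.mem_map] at hx
    obtain ⟨y, hy, rfl⟩ := hx
    simpa using hl.2 y hy

/-- The commutator of `w` with the word is again a reduced word, because the factor of `w` differs
from those of both end letters. -/
theorem not_commute_letterProd (hφ : ∀ i, Function.Injective (φ i)) {l : List (Σ i, G i)}
    (hl : IsReducedList φ l) (hne : l ≠ []) {w : Σ i, G i} (hw : w.2 ∉ (φ w.1).range)
    (hh : ∀ x ∈ l.head?, w.1 ≠ x.1) (ht : ∀ x ∈ l.getLast?, x.1 ≠ w.1) :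
    of (φ := φ) w.1 w.2 * letterProd φ l ≠ letterProd φ l * of w.1 w.2 := by
  intro h
  have hinv := hl.invLetters
  have hred : IsReducedList φ (w :: (l ++ ⟨w.1, w.2⁻¹⟩ :: invLetters l)) := by
    constructor
    · obtain ⟨x, m, rfl⟩ := List.exists_cons_of_ne_nil hne
      refine List.isChain_cons_cons.2 ⟨hh x rfl, List.isChain_append.2 ⟨hl.1, ?_, ?_⟩⟩
      · refine List.isChain_cons.2 ⟨?_, hinv.1⟩
        intro y hy
        simp only [PushoutI.invLetters, List.head?_reverse, List.getLast?_map, Option.mem_def,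
          Option.map_eq_some_iff] at hy
        obtain ⟨t, ht', rfl⟩ := hy
        exact (ht t ht').symm
      · intro y hy t ht'
        obtain rfl : _ = t := by simpa using ht'
        exact ht y hy
    · intro x hx
      simp only [List.mem_cons, List.mem_append] at hx
      rcases hx with rfl | hx | rfl | hx
      · exact hw
      · exact hl.2 x hx
      · simpa using hw
      · exact hinv.2 x hx
  refine hred.letterProd_ne_one hφ (by simp) ?_
  rw [letterProd_cons, letterProd_append, letterProd_cons, letterProd_invLetters, ← mul_assoc, h,
    map_inv]
  group

/-- A central element of an amalgamated product lies in one of the factors. -/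
theorem exists_of_mem_center (hφ : ∀ i, Function.Injective (φ i)) {g : PushoutI φ}
    (hg : g ∈ Subgroup.center (PushoutI φ)) :
    (∃ b, g = base φ b) ∨ ∃ i x, g = of i x := by
  obtain ⟨b, l, hl, hgl⟩ := exists_isReducedList hφ g
  rcases l with _ | ⟨x, l⟩
  · exact Or.inl ⟨b, by simpa [letterProd] using hgl⟩
  right
  -- The base part is absorbed into the first letter, which stays outside the base group.
  have hgx : g = of x.1 (φ x.1 b * x.2) * letterProd φ l := by
    rw [hgl, letterProd_cons, map_mul, of_apply_eq_base, mul_assoc]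
  rcases l with _ | ⟨y, l⟩
  · exact ⟨x.1, φ x.1 b * x.2, by simpa [letterProd] using hgx⟩
  exfalso
  have hx' : φ x.1 b * x.2 ∉ (φ x.1).range := fun h => hl.2 x (by simp)
    ((Subgroup.mul_mem_cancel_left _ (MonoidHom.mem_range.2 ⟨b, rfl⟩)).1 h)
  have hxy : x.1 ≠ y.1 := (List.isChain_cons_cons.1 hl.1).1
  have htail : IsReducedList φ (y :: l) :=
    ⟨(List.isChain_cons_cons.1 hl.1).2, fun t ht => hl.2 t (List.mem_cons_of_mem _ ht)⟩
  -- If the word does not end in the factor of its first letter, then that letter, commuting with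
  -- `g`, commutes with the tail. Otherwise both ends of the word lie in that factor, and the second
  -- letter, from another factor, cannot commute with `g`.
  by_cases hlast : ∀ t ∈ (y :: l).getLast?, t.1 ≠ x.1
  · refine not_commute_letterProd hφ htail (by simp) (w := ⟨x.1, φ x.1 b * x.2⟩) hx' ?_ hlast ?_
    · simpa using hxy
    · have h1 := Subgroup.mem_center_iff.1 hg (of x.1 (φ x.1 b * x.2))
      rw [hgx, mul_assoc] at h1
      exact mul_left_cancel h1
  · push Not at hlast
    obtain ⟨t, ht, htx⟩ := hlast
    refine not_commute_letterProd hφ (l := ⟨x.1, φ x.1 b * x.2⟩ :: y :: l) (w := y)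
      ⟨List.isChain_cons_cons.2 ⟨hxy, htail.1⟩, ?_⟩ (by simp) (htail.2 y (by simp)) ?_ ?_ ?_
    · intro s hs
      rcases List.mem_cons.1 hs with rfl | hs
      · exact hx'
      · exact htail.2 s hs
    · simpa using hxy.symm
    · intro s hs
      rw [List.getLast?_cons_cons] at hs
      obtain rfl : t = s := Option.mem_unique ht hs
      rw [htx]
      exact hxy
    · rw [letterProd_cons, ← hgx]
      exact Subgroup.mem_center_iff.1 hg _

end Monoid.PushoutI

/-! ### The Robinson amalgam as an iterated amalgamated product -/

namespace RobinsonSetup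

variable {p : ℕ} {S : Type u} [Group S] {𝒢 : PLocalCompactGroup p S} (R : RobinsonSetup 𝒢)

theorem hom_ext {K : Type u} [Group K] {f g : R.amalgam →* K}
    (h : ∀ v, f.comp (R.ofVertex v) = g.comp (R.ofVertex v)) : f = g := by
  have h1 : (GrpCat.ofHom f : R.amalgam ⟶ GrpCat.of K) = GrpCat.ofHom g := by
    refine colimit.hom_ext fun j => GrpCat.hom_ext (MonoidHom.ext fun n => ?_)
    rcases j with e | v
    · have hw := (congrArg (fun f => f.hom n)
        (colimit.w R.treeOfGroups (WalkingMultispan.Hom.fst e))).symm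
      exact (congrArg f hw).trans
        ((DFunLike.congr_fun (h R.vTop) (R.k e.1 e.2.1 e.2.2 n)).trans (congrArg g hw).symm)
    · exact DFunLike.congr_fun (h v) n
  exact congrArg GrpCat.Hom.hom h1

/-- The vertex `v_P` at the end of the edge `e_P`. -/
def edgeVertex (e : R.Edge) : R.Vertex := ⟨e.1, e.2.1⟩

theorem ofVertex_k (e : R.Edge) (n : R.N e.1 e.2.1 e.2.2) :
    R.ofVertex R.vTop (R.k e.1 e.2.1 e.2.2 n) = R.ofVertex (R.edgeVertex e) n.1 := by
  have h1 := colimit.w R.treeOfGroups (WalkingMultispan.Hom.fst e)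
  have h2 := colimit.w R.treeOfGroups (WalkingMultispan.Hom.snd e)
  exact congrArg (fun f => f.hom n) (h1.trans h2.symm)

/-- The two ends of an edge. -/
def endpoint (e : R.Edge) : Bool → SubgroupIn 𝒢.L.obj
  | true => 𝒢.topL
  | false => e.1

/-- The maps `k_P` and `j_P`. -/
def edgeMap (e : R.Edge) : ∀ b : Bool, R.N e.1 e.2.1 e.2.2 →* Aut (R.endpoint e b)
  | true => R.k e.1 e.2.1 e.2.2
  | false => (R.N e.1 e.2.1 e.2.2).subtype

theorem edgeMap_injective (e : R.Edge) : ∀ b, Function.Injective (R.edgeMap e b)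
  | true => R.k_injective e.1 e.2.1 e.2.2
  | false => Subtype.val_injective

/-- The amalgam `L_S *_{N_P} L_P`. -/
abbrev EdgeAmalgam (e : R.Edge) : Type u := Monoid.PushoutI (R.edgeMap e)

/-- The embedding of `L_S` in `L_S *_{N_P} L_P`. -/
def topToEdge (e : R.Edge) : Aut 𝒢.topL →* R.EdgeAmalgam e :=
  Monoid.PushoutI.of (φ := R.edgeMap e) true

theorem topToEdge_injective (e : R.Edge) : Function.Injective (R.topToEdge e) :=
  Monoid.PushoutI.of_injective (R.edgeMap_injective e) true

/-- The amalgam over `L_S` of the groups `L_S *_{N_P} L_P`. -/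
abbrev StarAmalgam : Type u := Monoid.PushoutI R.topToEdge

/-- The embedding of `L_P` in the iterated amalgam, for `P ≠ S`. -/
def edgeToStar (e : R.Edge) : Aut e.1 →* R.StarAmalgam :=
  (Monoid.PushoutI.of (φ := R.topToEdge) e).comp (Monoid.PushoutI.of (φ := R.edgeMap e) false)

theorem edgeToStar_injective (e : R.Edge) : Function.Injective (R.edgeToStar e) :=
  (Monoid.PushoutI.of_injective R.topToEdge_injective e).comp
    (Monoid.PushoutI.of_injective (R.edgeMap_injective e) false)

theorem eq_vTop {v : R.Vertex} (h : v.1.sub = ⊤) : v = R.vTop := by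
  obtain ⟨⟨P, hP⟩, hv⟩ := v
  obtain rfl : P = ⊤ := h
  rfl

open Classical in
/-- The embedding of a vertex group in the iterated amalgam. -/
noncomputable def vertexToStar (v : R.Vertex) : Aut v.1 →* R.StarAmalgam :=
  if h : v.1.sub = ⊤ then (R.eq_vTop h) ▸ (Monoid.PushoutI.base R.topToEdge)
  else R.edgeToStar ⟨v.1, v.2, h⟩

theorem vertexToStar_vTop (x : Aut 𝒢.topL) :
    R.vertexToStar R.vTop x = Monoid.PushoutI.base R.topToEdge x :=
  DFunLike.congr_fun (dif_pos rfl) x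

theorem vertexToStar_edgeVertex (e : R.Edge) (x : Aut e.1) :
    R.vertexToStar (R.edgeVertex e) x = R.edgeToStar e x :=
  DFunLike.congr_fun (dif_neg e.2.2) x

theorem vertexToStar_injective (v : R.Vertex) : Function.Injective (R.vertexToStar v) := by
  by_cases h : v.1.sub = ⊤
  · obtain rfl := R.eq_vTop h
    intro x y hxy
    exact Monoid.PushoutI.base_injective R.topToEdge_injective
      ((R.vertexToStar_vTop x).symm.trans (hxy.trans (R.vertexToStar_vTop y)))
  · intro x y hxy
    exact R.edgeToStar_injective ⟨v.1, v.2, h⟩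
      ((R.vertexToStar_edgeVertex ⟨v.1, v.2, h⟩ x).symm.trans
        (hxy.trans (R.vertexToStar_edgeVertex ⟨v.1, v.2, h⟩ y)))

theorem vertexToStar_k (e : R.Edge) (n : R.N e.1 e.2.1 e.2.2) :
    R.vertexToStar R.vTop (R.k e.1 e.2.1 e.2.2 n) = R.vertexToStar (R.edgeVertex e) n.1 := by
  refine (R.vertexToStar_vTop _).trans (Eq.trans ?_ (R.vertexToStar_edgeVertex e n.1).symm)
  rw [← Monoid.PushoutI.of_apply_eq_base R.topToEdge e]
  exact congrArg (Monoid.PushoutI.of (φ := R.topToEdge) e)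
    ((Monoid.PushoutI.of_apply_eq_base (R.edgeMap e) true n).trans
      (Monoid.PushoutI.of_apply_eq_base (R.edgeMap e) false n).symm)

/-- The iterated amalgam as a cocone on the Robinson tree of groups. -/
noncomputable def starCocone : Cocone R.treeOfGroups :=
  Multicofork.ofπ R.groups (GrpCat.of R.StarAmalgam) (fun v => GrpCat.ofHom (R.vertexToStar v))
    fun e => GrpCat.hom_ext (MonoidHom.ext fun n => R.vertexToStar_k e n)

/-- The map from the Robinson amalgam to the iterated amalgam. -/
noncomputable def toStar : R.amalgam →* R.StarAmalgam :=
  (colimit.desc R.treeOfGroups R.starCocone).hom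

theorem toStar_ofVertex (v : R.Vertex) (x : Aut v.1) :
    R.toStar (R.ofVertex v x) = R.vertexToStar v x :=
  DFunLike.congr_fun (congrArg GrpCat.Hom.hom
    (colimit.ι_desc R.starCocone (WalkingMultispan.right v))) x

/-- The factors of an amalgamated product embed in it, so vertex groups are already detected in the
iterated amalgam. -/
theorem ofVertex_injective (v : R.Vertex) : Function.Injective (R.ofVertex v) := by
  intro x y h
  apply R.vertexToStar_injective v
  rw [← toStar_ofVertex, ← toStar_ofVertex, h]

/-- The maps from the vertex groups at the ends of an edge to the Robinson amalgam. -/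
noncomputable def ofEndpoint (e : R.Edge) : ∀ b : Bool, Aut (R.endpoint e b) →* R.amalgam
  | true => R.ofVertex R.vTop
  | false => R.ofVertex (R.edgeVertex e)

/-- The map from the amalgam of an edge to the Robinson amalgam. -/
noncomputable def ofEdge (e : R.Edge) : R.EdgeAmalgam e →* R.amalgam :=
  Monoid.PushoutI.lift (R.ofEndpoint e)
    ((R.ofVertex (R.edgeVertex e)).comp (R.N e.1 e.2.1 e.2.2).subtype) (by
      rintro (_ | _)
      · rfl
      · ext n
        exact R.ofVertex_k e n)

theorem ofEdge_of (e : R.Edge) (b : Bool) (x : Aut (R.endpoint e b)) :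
    R.ofEdge e (Monoid.PushoutI.of (φ := R.edgeMap e) b x) = R.ofEndpoint e b x :=
  Monoid.PushoutI.lift_of (i := b) (R.ofEndpoint e) _ _ x

/-- The map from the iterated amalgam to the Robinson amalgam. -/
noncomputable def ofStar : R.StarAmalgam →* R.amalgam :=
  Monoid.PushoutI.lift R.ofEdge (R.ofVertex R.vTop) (by
    intro e
    ext x
    exact R.ofEdge_of e true x)

theorem ofStar_base (x : Aut 𝒢.topL) :
    R.ofStar (Monoid.PushoutI.base R.topToEdge x) = R.ofVertex R.vTop x :=
  Monoid.PushoutI.lift_base _ _ _ x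

theorem ofStar_of (e : R.Edge) (x : R.EdgeAmalgam e) :
    R.ofStar (Monoid.PushoutI.of (φ := R.topToEdge) e x) = R.ofEdge e x :=
  Monoid.PushoutI.lift_of _ _ _ x

theorem ofStar_toStar (g : R.amalgam) : R.ofStar (R.toStar g) = g := by
  have h : R.ofStar.comp R.toStar = MonoidHom.id _ := by
    refine R.hom_ext fun v => ?_
    ext x
    change R.ofStar (R.toStar (R.ofVertex v x)) = R.ofVertex v x
    rw [toStar_ofVertex]
    by_cases h : v.1.sub = ⊤
    · obtain rfl := R.eq_vTop h
      exact (congrArg R.ofStar (R.vertexToStar_vTop x)).trans (R.ofStar_base x)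
    · exact (congrArg R.ofStar (R.vertexToStar_edgeVertex ⟨v.1, v.2, h⟩ x)).trans
        ((R.ofStar_of ⟨v.1, v.2, h⟩ _).trans (R.ofEdge_of ⟨v.1, v.2, h⟩ false x))
  exact DFunLike.congr_fun h g

theorem toStar_ofEndpoint (e : R.Edge) : ∀ (b : Bool) (x : Aut (R.endpoint e b)),
    R.toStar (R.ofEndpoint e b x) =
      Monoid.PushoutI.of (φ := R.topToEdge) e (Monoid.PushoutI.of (φ := R.edgeMap e) b x)
  | true, x => (R.toStar_ofVertex R.vTop x).trans ((R.vertexToStar_vTop x).trans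
      (Monoid.PushoutI.of_apply_eq_base R.topToEdge e x).symm)
  | false, x =>
    (R.toStar_ofVertex (R.edgeVertex e) x).trans (R.vertexToStar_edgeVertex e x)

theorem toStar_ofStar (g : R.StarAmalgam) : R.toStar (R.ofStar g) = g := by
  have h : R.toStar.comp R.ofStar = MonoidHom.id _ := by
    refine Monoid.PushoutI.hom_ext (fun e => ?_) ?_
    · have : Nonempty Bool := ⟨true⟩
      refine Monoid.PushoutI.hom_ext_nonempty fun b => ?_
      ext x
      change R.toStar (R.ofStar (Monoid.PushoutI.of e _)) = _
      rw [ofStar_of, ofEdge_of]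
      exact R.toStar_ofEndpoint e b x
    · ext x
      exact (congrArg R.toStar (R.ofStar_base x)).trans
        ((R.toStar_ofVertex R.vTop x).trans (R.vertexToStar_vTop x))
  exact DFunLike.congr_fun h g

theorem ofEdge_injective (e : R.Edge) : Function.Injective (R.ofEdge e) := by
  intro x y h
  rw [← ofStar_of, ← ofStar_of] at h
  exact Monoid.PushoutI.of_injective R.topToEdge_injective e
    (Function.LeftInverse.injective R.toStar_ofStar h)

/-- Every central element of the Robinson amalgam lies in a vertex group. -/
theorem exists_ofVertex_of_mem_center {g : R.amalgam} (hg : g ∈ Subgroup.center R.amalgam) :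
    ∃ v x, g = R.ofVertex v x := by
  have hc : R.toStar g ∈ Subgroup.center R.StarAmalgam := by
    rw [Subgroup.mem_center_iff] at hg ⊢
    intro h
    rw [← R.toStar_ofStar h, ← map_mul, ← map_mul, hg]
  -- The first application places the element in `L_S` or in one `L_S *_{N_P} L_P`. It remains
  -- central there, so a second application places it in `L_S` or `L_P`.
  rcases Monoid.PushoutI.exists_of_mem_center R.topToEdge_injective hc with ⟨x, hx⟩ | ⟨e, y, hy⟩
  · exact ⟨R.vTop, x, by rw [← R.ofStar_toStar g, hx, ofStar_base]⟩
  have hgy : g = R.ofEdge e y := by rw [← R.ofStar_toStar g, hy, ofStar_of]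
  have hyc : y ∈ Subgroup.center (R.EdgeAmalgam e) := by
    rw [Subgroup.mem_center_iff] at hg ⊢
    intro h
    apply R.ofEdge_injective e
    rw [map_mul, map_mul, ← hgy, hg]
  rcases Monoid.PushoutI.exists_of_mem_center (R.edgeMap_injective e) hyc with
    ⟨n, hn⟩ | ⟨b, x, hx⟩
  · refine ⟨R.edgeVertex e, n.1, ?_⟩
    rw [hgy, hn, ← Monoid.PushoutI.of_apply_eq_base (R.edgeMap e) false, ofEdge_of]
    rfl
  · rw [hx, ofEdge_of] at hgy
    rcases b with _ | _
    · exact ⟨R.edgeVertex e, x, hgy⟩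
    · exact ⟨R.vTop, x, hgy⟩

end RobinsonSetup

/-! ### Automorphism groups in the linking system -/

namespace TransporterData

variable {p : ℕ} {S : Type u} [Group S] {F : FusionSystem S} {T : TransporterData F}

theorem εAut_injective (hT : T.IsTransporterSystem p) (P : SubgroupIn T.obj) :
    Function.Injective (T.εAut P) := by
  intro g h hgh
  exact Subtype.ext (hT.ε_injective _ _ _ _ (congrArg Iso.hom hgh))

/-- `ε(P)` as a subgroup of `Aut_T(P)`. -/
def εSelf (T : TransporterData F) (P : SubgroupIn T.obj) : P.sub →* Aut P :=
  (T.εAut P).comp (Subgroup.inclusion Subgroup.le_normalizer)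

theorem εSelf_injective (hT : T.IsTransporterSystem p) (P : SubgroupIn T.obj) :
    Function.Injective (T.εSelf P) :=
  (εAut_injective hT P).comp (Subgroup.inclusion_injective _)

/-- Multiplication in `Aut` is composition in the order of functions, so this is the axiom `comm`.
It makes centralising elements of `ε(P)` the same as fixing elements of `P`. -/
theorem mul_εSelf (hT : T.IsTransporterSystem p) {P : SubgroupIn T.obj} (a : Aut P) (y : P.sub) :
    a * T.εSelf P y = T.εSelf P (T.ρ a.hom y) * a :=
  Iso.ext (hT.comm a.hom y)

theorem commute_εSelf_iff (hT : T.IsTransporterSystem p) {P : SubgroupIn T.obj} (a : Aut P)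
    (y : P.sub) : a * T.εSelf P y = T.εSelf P y * a ↔ T.ρ a.hom y = y := by
  rw [mul_εSelf hT, mul_left_inj, (εSelf_injective hT P).eq_iff]

/-- Lift `e` and its inverse to `φ` and `ψ`. Both composites lie over the identity and are therefore
invertible, so `φ` has a left and a right inverse, and these agree. -/
theorem exists_aut_of_isIso (hT : T.IsTransporterSystem p) {P : SubgroupIn T.obj}
    {e : P.sub ≃* P.sub} (he : F.IsIso e) : ∃ a : Aut P, T.ρ a.hom = e.toMonoidHom := by
  obtain ⟨φ, hφ⟩ := hT.ρ_surjective (P := P) (Q := P) _ he.1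
  obtain ⟨ψ, hψ⟩ := hT.ρ_surjective (P := P) (Q := P) _ he.2
  obtain ⟨a, -, ha⟩ := (hT.ρ_orbit (𝟙 P) (φ ≫ ψ)).1 (by
    rw [T.ρ_comp, T.ρ_id, hφ, hψ]
    ext x
    simp)
  obtain ⟨b, -, hb⟩ := (hT.ρ_orbit (𝟙 P) (ψ ≫ φ)).1 (by
    rw [T.ρ_comp, T.ρ_id, hφ, hψ]
    ext x
    simp)
  rw [Category.comp_id] at ha hb
  have h1 : φ ≫ ψ ≫ a.inv = 𝟙 P := by rw [← Category.assoc, ← ha, a.hom_inv_id]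
  have h2 : (b.inv ≫ ψ) ≫ φ = 𝟙 P := by rw [Category.assoc, ← hb, b.inv_hom_id]
  have h3 : b.inv ≫ ψ = ψ ≫ a.inv := by
    rw [← Category.comp_id (b.inv ≫ ψ), ← h1, ← Category.assoc, h2, Category.id_comp]
  exact ⟨⟨φ, ψ ≫ a.inv, h1, h3 ▸ h2⟩, hφ⟩

end TransporterData

/-! ### Elements of the centre of a `p`-local compact group -/

namespace PLocalCompactGroup

variable {p : ℕ} {S : Type u} [Group S] (𝒢 : PLocalCompactGroup p S)

/-- The component in `Z(P)` of an element of the centre. -/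
noncomputable def centreProj (P : 𝒢.F.OrbitCat) : 𝒢.centre →* Subgroup.center P.sub :=
  (limit.π 𝒢.F.centerFunctor (Opposite.op P)).hom

theorem apply_centreProj (c : 𝒢.centre) {P Q : 𝒢.F.OrbitCat} (f : 𝒢.F.Hom P.sub Q.sub) :
    f.1 (𝒢.centreProj P c) = 𝒢.centreProj Q c := by
  let φ : P ⟶ Q := Quotient.mk _ f
  have h : FusionSystem.centerMap P.centric f (𝒢.centreProj Q c) = 𝒢.centreProj P c :=
    congrArg (fun f => f.hom c) (limit.w 𝒢.F.centerFunctor φ.op)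
  rw [← h, FusionSystem.apply_centerMap]

/-- The inclusion of `P` in `S` is a morphism of the orbit category, so all components of `c` are
the same element of `S`. -/
theorem coe_centreProj (c : 𝒢.centre) (P : 𝒢.F.OrbitCat) :
    ((𝒢.centreProj P c : P.sub) : S) = (𝒢.centreProj 𝒢.topO c : 𝒢.topO.sub) :=
  congrArg Subtype.val (𝒢.apply_centreProj c (Q := 𝒢.topO)
    ⟨Subgroup.inclusion le_top, FusionSystem.inclusion_mem le_top⟩)

theorem centreProj_topO_injective : Function.Injective (𝒢.centreProj 𝒢.topO) := by
  intro c d h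
  refine Concrete.limit_ext 𝒢.F.centerFunctor c d fun j => ?_
  change 𝒢.centreProj j.unop c = 𝒢.centreProj j.unop d
  refine Subtype.ext (Subtype.ext ?_)
  exact (𝒢.coe_centreProj c _).trans
    ((congrArg (fun t : Subgroup.center 𝒢.topO.sub => (t.1 : S)) h).trans (𝒢.coe_centreProj d _).symm)

open scoped IsMulCommutative in
-- The constant family `z` is compatible, so its powers give a cone with infinite cyclic apex. The
-- image of the generator under the induced map to the limit is the required element.
theorem exists_centreProj_eq {z : S} (hz : ∀ g : S, g * z = z * g)
    (hfix : ∀ P, 𝒢.F.IsCentric P → 𝒢.F.Fixes z P) :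
    ∃ c, ((𝒢.centreProj 𝒢.topO c : 𝒢.topO.sub) : S) = z := by
  let zP : ∀ P : 𝒢.F.OrbitCat, Subgroup.center P.sub := fun P =>
    ⟨⟨z, P.centric.mem_of_central hz⟩, Subgroup.mem_center_iff.2 fun g => Subtype.ext (hz g)⟩
  let m : ∀ P : 𝒢.F.OrbitCat, ULift.{u} (Multiplicative ℤ) →* Subgroup.center P.sub :=
    fun P => (zpowersHom _ (zP P)).comp MulEquiv.ulift.toMonoidHom
  have hm : ∀ (P Q : 𝒢.F.OrbitCat) (f : 𝒢.F.Hom P.sub Q.sub) (n),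
      FusionSystem.centerMap P.centric f (m Q n) = m P n := by
    intro P Q f n
    have h1 : FusionSystem.centerMap P.centric f (zP Q) = zP P := by
      refine FusionSystem.centerMap_eq_of_apply _ _ _ _ (Subtype.ext ?_)
      exact hfix P.sub P.centric _ (𝒢.F.comp_mem _ f.2 _ (FusionSystem.inclusion_mem le_top))
        (P.centric.mem_of_central hz)
    change FusionSystem.centerMap P.centric f (zP Q ^ n.down.toAdd) = zP P ^ n.down.toAdd
    rw [map_zpow, h1]
  let K : Cone 𝒢.F.centerFunctor :=
    { pt := CommGrpCat.of (ULift.{u} (Multiplicative ℤ))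
      π :=
        { app := fun P => CommGrpCat.ofHom (m P.unop)
          naturality := by
            rintro ⟨Q⟩ ⟨P⟩ ⟨φ⟩
            induction φ using Quotient.inductionOn with | _ f
            exact CommGrpCat.hom_ext (MonoidHom.ext fun n => (hm P Q f n).symm) } }
  refine ⟨(limit.lift _ K).hom (ULift.up (Multiplicative.ofAdd 1)), ?_⟩
  have h1 : 𝒢.centreProj 𝒢.topO ((limit.lift _ K).hom (ULift.up (Multiplicative.ofAdd 1))) =
      m 𝒢.topO (ULift.up (Multiplicative.ofAdd 1)) :=
    congrArg (fun f => f.hom (ULift.up (Multiplicative.ofAdd 1)))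
      (limit.lift_π K (Opposite.op 𝒢.topO))
  rw [h1]
  change (((zP 𝒢.topO ^ (1 : ℤ) : Subgroup.center _) : 𝒢.topO.sub) : S) = z
  rw [zpow_one]

end PLocalCompactGroup

/-! ### The centre of the Robinson amalgam -/

namespace RobinsonSetup

variable {p : ℕ} {S : Type u} [Group S] {𝒢 : PLocalCompactGroup p S} (R : RobinsonSetup 𝒢)

theorem isCentric_of_vertex (v : R.Vertex) : 𝒢.F.IsCentric v.1.sub :=
  𝒢.linking.obj_eq.le v.1.mem

theorem ofVertex_εAut (v : R.Vertex) (g : Subgroup.normalizer (v.1.sub : Set S)) :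
    R.ofVertex v (𝒢.L.εAut v.1 g) = R.ofVertex R.vTop (𝒢.εTop ⟨g, Subgroup.mem_top _⟩) := by
  by_cases h : v.1.sub = ⊤
  · obtain rfl := R.eq_vTop h
    rfl
  · let e : R.Edge := ⟨v.1, v.2, h⟩
    have h1 := R.ofVertex_k e ⟨_, R.normalizer_mem e.1 e.2.1 e.2.2 g⟩
    rw [R.k_normalizer e.1 e.2.1 e.2.2 g] at h1
    exact h1.symm

theorem ofVertex_εSelf (v : R.Vertex) (y : v.1.sub) :
    R.ofVertex v (𝒢.L.εSelf v.1 y) = R.ofVertex R.vTop (𝒢.εTop ⟨y, Subgroup.mem_top _⟩) :=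
  R.ofVertex_εAut v _

theorem centreToAmalgam_apply (c : 𝒢.centre) :
    R.centreToAmalgam c = R.ofVertex R.vTop (𝒢.εTop (𝒢.centreProj 𝒢.topO c : 𝒢.topO.sub)) :=
  rfl

theorem centreToAmalgam_injective : Function.Injective R.centreToAmalgam := by
  intro c d h
  rw [centreToAmalgam_apply, centreToAmalgam_apply] at h
  exact 𝒢.centreProj_topO_injective (Subtype.ext
    (TransporterData.εSelf_injective 𝒢.linking.toIsTransporterSystem 𝒢.topL
      (R.ofVertex_injective R.vTop h)))

/-- An element that commutes with all vertex groups is central. -/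
theorem mem_center_of_commute {g : R.amalgam}
    (h : ∀ v x, R.ofVertex v x * g = g * R.ofVertex v x) : g ∈ Subgroup.center R.amalgam := by
  have h1 : (MulAut.conj g).toMonoidHom = MonoidHom.id R.amalgam := by
    refine R.hom_ext fun v => MonoidHom.ext fun x => ?_
    change g * R.ofVertex v x * g⁻¹ = R.ofVertex v x
    rw [← h, mul_inv_cancel_right]
  rw [Subgroup.mem_center_iff]
  intro x
  have h2 : g * x * g⁻¹ = x := DFunLike.congr_fun h1 x
  exact (mul_inv_eq_iff_eq_mul.1 h2).symm

/-- At each vertex the image of `c` can be rewritten as `ε_P` of its component in `Z(P)`. That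
component is fixed by `Aut_F(P)`, so the image commutes with `L_P`. -/
theorem centreToAmalgam_mem_center (c : 𝒢.centre) :
    R.centreToAmalgam c ∈ Subgroup.center R.amalgam := by
  refine R.mem_center_of_commute fun v x => ?_
  let P : 𝒢.F.OrbitCat := ⟨v.1.sub, R.isCentric_of_vertex v⟩
  let y : v.1.sub := (𝒢.centreProj P c : P.sub)
  have h1 : R.centreToAmalgam c = R.ofVertex v (𝒢.L.εSelf v.1 y) := by
    rw [ofVertex_εSelf, centreToAmalgam_apply]
    have h2 : (𝒢.centreProj 𝒢.topO c : 𝒢.topO.sub) = (⟨y, Subgroup.mem_top _⟩ : (⊤ : Subgroup S)) :=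
      Subtype.ext (𝒢.coe_centreProj c P).symm
    rw [h2]
  have h3 : 𝒢.L.ρ x.hom y = y := 𝒢.apply_centreProj c (P := P) (Q := P) ⟨_, 𝒢.L.ρ_mem x.hom⟩
  rw [h1, ← map_mul, ← map_mul,
    (TransporterData.commute_εSelf_iff 𝒢.linking.toIsTransporterSystem x y).2 h3]

/-- A central element coming from `x ∈ L_P` centralises `ε(P)`, so `x` acts trivially on `P`; the
linking axiom `E(P) = ε(Z(P))` then brings it back to `S`. -/
theorem exists_εTop_of_mem_center {g : R.amalgam} (hg : g ∈ Subgroup.center R.amalgam) :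
    ∃ z : (⊤ : Subgroup S), g = R.ofVertex R.vTop (𝒢.εTop z) := by
  have hT := 𝒢.linking.toIsTransporterSystem
  obtain ⟨v, x, rfl⟩ := R.exists_ofVertex_of_mem_center hg
  have hx : x ∈ 𝒢.L.E v.1 := by
    rw [TransporterData.E, MonoidHom.mem_ker]
    refine MulEquiv.ext fun y => ?_
    change 𝒢.L.ρ x.hom y = y
    rw [← TransporterData.commute_εSelf_iff hT]
    apply R.ofVertex_injective v
    rw [map_mul, map_mul, Subgroup.mem_center_iff.1 hg]
  rw [𝒢.linking.E_eq] at hx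
  obtain ⟨_, ⟨w, -, rfl⟩, rfl⟩ := hx
  exact ⟨⟨w, Subgroup.mem_top _⟩, R.ofVertex_εSelf v w⟩

/-- Commuting with `ε(S)` makes `z` central in `S`, and commuting with `L_P` makes it fixed by
`Aut_F(P)`, whose elements all lift to `L_P`. The fusion argument then produces an element of the
limit. -/
theorem center_le_range [Fact p.Prime] :
    Subgroup.center R.amalgam ≤ R.centreToAmalgam.range := by
  intro g hg
  have hT := 𝒢.linking.toIsTransporterSystem
  obtain ⟨z, rfl⟩ := R.exists_εTop_of_mem_center hg
  rw [Subgroup.mem_center_iff] at hg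
  have hz : ∀ s : S, s * z = z * s := by
    intro s
    have h1 := hg (R.ofVertex R.vTop (𝒢.εTop ⟨s, Subgroup.mem_top s⟩))
    have h2 := R.ofVertex_injective R.vTop
      ((map_mul (R.ofVertex R.vTop) _ _).trans (h1.trans (map_mul (R.ofVertex R.vTop) _ _).symm))
    have h3 := TransporterData.εSelf_injective hT 𝒢.topL
      ((map_mul 𝒢.εTop _ _).trans (h2.trans (map_mul 𝒢.εTop _ _).symm))
    exact congrArg Subtype.val h3
  have hfix : ∀ P ∈ R.fam, ∀ e ∈ 𝒢.F.aut P, ∀ hzP : (z : S) ∈ P, (e ⟨z, hzP⟩ : S) = z := by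
    intro P hP e he hzP
    let v : R.Vertex := ⟨⟨P, R.fam_subset hP⟩, hP⟩
    obtain ⟨a, ha⟩ := TransporterData.exists_aut_of_isIso hT (P := v.1) he
    have h1 : 𝒢.L.ρ a.hom ⟨z, hzP⟩ = ⟨z, hzP⟩ := by
      rw [← TransporterData.commute_εSelf_iff hT]
      apply R.ofVertex_injective v
      rw [map_mul, map_mul, ofVertex_εSelf]
      exact hg _
    rw [ha] at h1
    exact congrArg Subtype.val h1
  obtain ⟨c, hc⟩ := 𝒢.exists_centreProj_eq hz fun P hP =>
    𝒢.saturated.fixes_of_isFusionControlling 𝒢.toral R.controlling hz hfix hP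
  refine ⟨c, ?_⟩
  rw [centreToAmalgam_apply]
  have : (𝒢.centreProj 𝒢.topO c : 𝒢.topO.sub) = z := Subtype.ext hc
  rw [this]

end RobinsonSetup

theorem mainTheorem3 {p : ℕ} [Fact p.Prime] {S : Type u} [Group S] (𝒢 : PLocalCompactGroup p S)
    (R : RobinsonSetup 𝒢) :
    Function.Injective R.centreToAmalgam ∧
      R.centreToAmalgam.range = Subgroup.center R.amalgam := by
  refine ⟨R.centreToAmalgam_injective, le_antisymm ?_ R.center_le_range⟩
  rintro _ ⟨c, rfl⟩
  exact R.centreToAmalgam_mem_center c
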